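/- **Terms.** Terms are $t,u ::= x \mid \lambda x.t \mid t\,u$, with size $|x|=1$, $|\lambda x.t|=|t|+1$, $|t\,u|=|t|+|u|+1$. *Bites* are $b ::= x\,y \mid v$, *crumbled values* are $v ::= \lambda x.[*\leftarrow y] \mid \lambda x.E$, and *environments* are finite sequences $E$ of explicit substitutions $[z\leftarrow b]$, where $z$ is a variable or the special variable $*$. The entry $[z\leftarrow b]$ binds $z$ in the entries on its left. **Crumbling.** The crumbling $\underline t$ of a term $t$ that is not a variable is defined by $\underline{x\,y}=[*\leftarrow x\,y]$; $\underline{\lambda x.y}=[*\leftarrow\lambda x.[*\leftarrow y]]$; $\underline{\lambda x.t}=[*\leftarrow\lambda x.\underline t]$ if $t$ is not a variable; and, for $u,u'$ that are not variables with $\underline u=[*\leftarrow b]E$, $\underline{u'}=[*\leftarrow b']E'$, and for fresh $x$, $y$ (respectively, for the variable $x$ or $y$ that occurs in the term), $$\underline{u\,y}=[*\leftarrow x\,y][x\leftarrow b]E,\qquad \underline{x\,u'}=[*\leftarrow x\,y][y\leftarrow b']E',\qquad \underline{u\,u'}=[*\leftarrow x\,y][x\leftarrow b]E[y\leftarrow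 b']E'.$$ **The machine.** A state of the Reversible Crumbling Abstract Machine (RCAM) is a triple $(E,E_v,H)$: the active environment, the evaluated environment (all of whose bites are values), and the history stack, whose entries are $\langle\rangle$ or $\langle x,y\rangle$. The initial state of $E$ is $\iota(E)=(E,\epsilon,\epsilon)$. The forward transitions are * (search) $(E_1[x\leftarrow v],E_v,H)\rightsquigarrow_{sea}(E_1,[x\leftarrow v]E_v,\langle\rangle:H)$ for a value $v$; * $(E_1[z\leftarrow x\,y],E_v,H)\rightsquigarrow_{m_1}(E_1[z\leftarrow b']E',E_v,\langle x,y\rangle:H)$, if $E_v(x)$, after renaming the variables defined in its body with fresh ones, is $\lambda x_1.[*\leftarrow b]E$, and $([*\leftarrow b]E)\{x_1\leftarrow y\}=[*\leftarrow b']E'$; * $(E_1[z\leftarrow x\,y],E_v,H)\rightsquigarrow_{m_2}(E_1,[z\leftarrow E_v(y_1')]E_v,\langle x,y\rangle:H)$, if $E_v(x)=\lambda x_1.[*\leftarrow y_1]$ and $y_1'=y_1\{x_1\leftarrow y\}$. The transitions $m_1$ and $m_2$ are called principal, and $|\rho|_p$ is the number of principal transitions of an execution $\rho$. **Implementation on a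 RAM.** Consider random access machines with natural-number memory cells, whose instructions are: load a constant, add, subtract (truncated), indirect load, indirect store, and jump if zero. Each instruction costs one unit. A memory *represents* an RCAM state if it contains the state as a linked data structure: each explicit substitution is a node of four consecutive cells (a link and the description of its bite), variables are represented by addresses (an explicitly substituted variable by the address of its node), the active environment and the bodies of abstractions are lists linked from right to left, the evaluated environment is a list linked from left to right, the history stack is a linked list, and three fixed cells point to the active environment, to the evaluated environment and to the history stack. In the *initial memory* for $\iota(E)$, the environment $E$ is laid out consecutively in this format after a fixed number of working cells, the node of each abstraction being directly followed by a block that consists of a cell for the bound variable, which contains the address of the last cell of the block, and then of the body (the block of $\lambda x.[*\leftarrow y]$ is just the cell for $x$); one further fixed cell contains the first unused address. A program *implements* an execution $\rho$ if its run passes successively through representations of all the states of $\rho$. **Theorem (the RCAM is bi-linear).** There are a RAM program $P$, a number of working cells and a constant $c$ such that, for every closed term $t$ and every forward RCAM execution $\rho:\iota(\underline t)\rightsquigarrow^* S$, the program $P$, started on the initial memory for $\iota(\underline t)$, implements $\rho$ and reaches a representation of the last state $S$ after a number of steps that is at most $$c\cdot(|\rho|_p+1)\cdot|t|.$$ If moreover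 the active environment of $S$ is empty, then $P$ has halted within that number of steps, with a representation of $S$ in its memory. -/

import Mathlib

namespace RCAM

/-! ### Plotkin's terms -/

/-- Terms of Plotkin's calculus; variables are natural numbers. -/
inductive Term where
  | var (x : ℕ)
  | lam (x : ℕ) (t : Term)
  | app (t u : Term)

namespace Term

/-- `|x| = 1`, `|λx.t| = |t| + 1`, `|t u| = |t| + |u| + 1`. -/
def size : Term → ℕ
  | var _ => 1
  | lam _ t => t.size + 1
  | app t u => t.size + u.size + 1

def fv : Term → Finset ℕ
  | var x => {x}
  | lam x t => t.fv.erase x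
  | app t u => t.fv ∪ u.fv

def Closed (t : Term) : Prop := t.fv = ∅

/-- A number strictly greater than every variable (free or bound) of the term. -/
def bound : Term → ℕ
  | var x => x + 1
  | lam x t => max (x + 1) t.bound
  | app t u => max t.bound u.bound

end Term

/-! ### Bites, environments, crumbles

An environment is the list of its explicit substitutions, written from left to right.  The
variable of an entry is `some z`, or `none` for the special variable `*` (which never occurs
inside a bite). -/

/-- Bites: an application `x y` of two variables, an identity or constant function `λx.[* ← y]`,
or an abstraction `λx.E` whose body `E` is an environment. -/
inductive Bite where
  | app (x y : ℕ)
  | ret (x y : ℕ)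
  | lam (x : ℕ) (E : List (Option ℕ × Bite))

/-- Environments. -/
abbrev Env := List (Option ℕ × Bite)

/-- The crumbled values are the bites of the form `λx.[* ← y]` and `λx.E`. -/
def Bite.IsValue : Bite → Prop
  | .app _ _ => False
  | .ret _ _ => True
  | .lam _ _ => True

/-- The variables, other than `*`, that the entries of an environment define. -/
def Env.dom (E : Env) : Finset ℕ := (E.filterMap Prod.fst).toFinset

mutual
/-- Free variables of a bite. -/
def Bite.fv : Bite → Finset ℕ
  | .app x y => {x, y}
  | .ret x y => ({y} : Finset ℕ).erase x
  | .lam x E => (Env.fv E).erase x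
/-- Free variables of an environment: an entry binds its variable in the entries on its left. -/
def Env.fv : Env → Finset ℕ
  | [] => ∅
  | (_, b) :: E => (Bite.fv b \ Env.dom E) ∪ Env.fv E
end

mutual
/-- All variables other than `*` that occur in a bite: free, bound by an abstraction, or defined
by an entry of a body, at any depth. -/
def Bite.names : Bite → Finset ℕ
  | .app x y => {x, y}
  | .ret x y => {x, y}
  | .lam x E => insert x (Env.names E)
/-- All variables other than `*` that occur in an environment. -/
def Env.names : Env → Finset ℕ
  | [] => ∅
  | (z, b) :: E => z.toFinset ∪ Bite.names b ∪ Env.names E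
end

mutual
/-- Replacement of the free occurrences of variables according to `θ`. -/
def Bite.rename (θ : ℕ → ℕ) : Bite → Bite
  | .app x y => .app (θ x) (θ y)
  | .ret x y => .ret x (if y = x then y else θ y)
  | .lam x E => .lam x (Env.rename (fun w => if w = x ∨ w ∈ Env.dom E then w else θ w) E)
/-- Replacement of variables according to `θ` in all bites of an environment; the variables
that the entries define stay. -/
def Env.rename (θ : ℕ → ℕ) : Env → Env
  | [] => []
  | (z, b) :: E => (z, Bite.rename θ b) :: Env.rename θ E
end

/-- Renaming of the variables defined by the entries of an environment, together with all
their occurrences in it. -/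
def Env.renameDom (α : ℕ → ℕ) (E : Env) : Env :=
  (Env.rename α E).map fun e => (e.1.map α, e.2)

/-- The variable-for-variable substitution `E{x ← y}`. -/
def Env.subst (x y : ℕ) (E : Env) : Env := Env.rename (Function.update id x y) E

/-! ### The crumbling translation -/

/-- `[* ← b] E` becomes `[x ← b] E`. -/
def Env.assign (x : ℕ) : Env → Env
  | [] => []
  | (_, b) :: E => (some x, b) :: E

/-- The crumbling translation, where `n` is the first name not used yet; the second component
of the result is the first name not used afterwards.  (Variables have no translation; the
first line is a dummy value, and closed terms are not variables.) -/
def crumbFrom : Term → ℕ → Env × ℕ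
  | .var _, n => ([], n)
  | .lam x (.var y), n => ([(none, .ret x y)], n)
  | .lam x t, n =>
      let r := crumbFrom t n
      ([(none, .lam x r.1)], r.2)
  | .app (.var x) (.var y), n => ([(none, .app x y)], n)
  | .app u (.var y), n =>
      let r := crumbFrom u (n + 1)
      ((none, .app n y) :: Env.assign n r.1, r.2)
  | .app (.var x) u, n =>
      let r := crumbFrom u (n + 1)
      ((none, .app x n) :: Env.assign n r.1, r.2)
  | .app u u', n =>
      let r := crumbFrom u (n + 2)
      let r' := crumbFrom u' r.2
      ((none, .app n (n + 1)) :: (Env.assign n r.1 ++ Env.assign (n + 1) r'.1), r'.2)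

/-- The crumbling of a term. -/
def crumb (t : Term) : Env := (crumbFrom t t.bound).1

/-! ### The Reversible Crumbling Abstract Machine (forward transitions) -/

/-- An entry of the history stack: `none` is `⟨⟩`, and `some (x, y)` is `⟨x, y⟩`. -/
abbrev HistEntry := Option (ℕ × ℕ)

/-- States: active environment, evaluated environment, history stack. -/
structure State where
  act : Env
  ev : Env
  hist : List HistEntry

/-- The initial state `ι(E)`. -/
def State.init (E : Env) : State := ⟨E, [], []⟩

/-- `α` renames the variables in `D` apart, to names that occur nowhere in `E`, and is the
identity elsewhere. -/
def FreshRenaming (α : ℕ → ℕ) (D : Finset ℕ) (E : Env) : Prop :=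
  (∀ z, z ∉ D → α z = z) ∧ Set.InjOn α D ∧ ∀ z ∈ D, α z ∉ Env.names E

/-- The names of the forward transitions. -/
inductive Label where
  | sea
  | m1
  | m2

/-- The forward transitions.  In `m1`, `B` is the body of the abstraction, its defined variables
are renamed with fresh names, and then `y` is substituted for `x₁`. -/
inductive Step : Label → State → State → Prop
  | sea (E₁ Ev : Env) (H : List HistEntry) (x : Option ℕ) (v : Bite) (hv : v.IsValue) :
      Step .sea ⟨E₁ ++ [(x, v)], Ev, H⟩ ⟨E₁, (x, v) :: Ev, none :: H⟩
  | m1 (E₁ Ev : Env) (H : List HistEntry) (z : Option ℕ) (x y x₁ : ℕ) (B : Env) (α : ℕ → ℕ)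
      (b' : Bite) (E' : Env)
      (hx : Ev.lookup (some x) = some (.lam x₁ B))
      (hα : FreshRenaming α (Env.dom B) (E₁ ++ (z, .app x y) :: Ev))
      (hB : Env.subst x₁ y (Env.renameDom α B) = (none, b') :: E') :
      Step .m1 ⟨E₁ ++ [(z, .app x y)], Ev, H⟩ ⟨E₁ ++ (z, b') :: E', Ev, some (x, y) :: H⟩
  | m2 (E₁ Ev : Env) (H : List HistEntry) (z : Option ℕ) (x y x₁ y₁ : ℕ) (v : Bite)
      (hx : Ev.lookup (some x) = some (.ret x₁ y₁))
      (hv : Ev.lookup (some (Function.update id x₁ y y₁)) = some v) :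
      Step .m2 ⟨E₁ ++ [(z, .app x y)], Ev, H⟩ ⟨E₁, (z, v) :: Ev, some (x, y) :: H⟩

/-- Forward executions from `S₀`. -/
inductive Execution (S₀ : State) : State → Type
  | refl : Execution S₀ S₀
  | tail {S S' : State} (ρ : Execution S₀ S) (l : Label) (h : Step l S S') : Execution S₀ S'

/-- `1` for a principal transition, `0` for a search transition. -/
def Label.principal : Label → ℕ
  | .sea => 0
  | .m1 => 1
  | .m2 => 1

/-- `|ρ|_p`, the number of principal transitions of an execution. -/
def Execution.principal {S₀ : State} : {S : State} → Execution S₀ S → ℕ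
  | _, .refl => 0
  | _, .tail ρ l _ => ρ.principal + l.principal

/-! ### Random access machines, with uniform cost -/

/-- Instructions.  `X i` is the content, a natural number, of the memory cell with address `i`. -/
inductive Instr where
  /-- `X d := c` -/
  | const (d c : ℕ)
  /-- `X d := X i + X j` -/
  | add (d i j : ℕ)
  /-- `X d := X i - X j` (truncated subtraction) -/
  | sub (d i j : ℕ)
  /-- `X d := X (X i)` -/
  | load (d i : ℕ)
  /-- `X (X d) := X i` -/
  | store (d i : ℕ)
  /-- if `X i = 0` then go to instruction number `l` -/
  | jumpZero (i l : ℕ)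

/-- The finite programs of the machine. -/
abbrev Program := List Instr

/-- A configuration: program counter and memory. -/
structure Config where
  pc : ℕ
  mem : ℕ → ℕ

/-- Effect of one instruction. -/
def Instr.exec (s : Config) : Instr → Config
  | .const d c => ⟨s.pc + 1, Function.update s.mem d c⟩
  | .add d i j => ⟨s.pc + 1, Function.update s.mem d (s.mem i + s.mem j)⟩
  | .sub d i j => ⟨s.pc + 1, Function.update s.mem d (s.mem i - s.mem j)⟩
  | .load d i => ⟨s.pc + 1, Function.update s.mem d (s.mem (s.mem i))⟩
  | .store d i => ⟨s.pc + 1, Function.update s.mem (s.mem d) (s.mem i)⟩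
  | .jumpZero i l => ⟨if s.mem i = 0 then l else s.pc + 1, s.mem⟩

/-- The program has halted when the program counter points outside of it. -/
def Config.Halted (P : Program) (s : Config) : Prop := P.length ≤ s.pc

/-- One step of the machine; a halted machine does not move. -/
def Program.step (P : Program) (s : Config) : Config :=
  match P[s.pc]? with
  | some i => i.exec s
  | none => s

/-- The configuration after `n` steps. -/
def Program.run (P : Program) (s : Config) (n : ℕ) : Config := (P.step)^[n] s

/-! ### Machine states as linked data structures in memory

A variable is represented by an address.  An explicit substitution `[z ← b]` is a node of four
consecutive cells, whose address `a` represents `z`: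
* cell `a` is a link to a neighbouring node (`0` is the null pointer);
* cells `a + 1`, `a + 2`, `a + 3` describe `b`: they contain
  `0`, the address of `x`, the address of `y` if `b` is `x y`;
  `1`, the address standing for `x`, the address of `y` if `b` is `λx.[* ← y]`;
  `2`, the address standing for `x`, the address of the rightmost node of `E` if `b` is `λx.E`.
Bodies and active environments are linked from right to left, evaluated environments from left
to right. -/

/-- The nodes `as` form a null-terminated linked list that starts at `p`. -/
def Linked (m : ℕ → ℕ) : ℕ → List ℕ → Prop
  | p, [] => p = 0
  | p, a :: as => p = a ∧ a ≠ 0 ∧ Linked m (m a) as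

/-- `ρ`, modified to map the variable of each entry of an environment to the address of the
corresponding node. -/
def bind (ρ : ℕ → ℕ) : Env → List ℕ → ℕ → ℕ
  | (some z, _) :: E, a :: as => Function.update (bind ρ E as) z a
  | (none, _) :: E, _ :: as => bind ρ E as
  | _, _ => ρ

mutual
/-- The memory `m` contains at node `a` the bite, where `ρ` gives the addresses of the free
variables.  Bound variables are represented by addresses that are distinct from each other and
from those of the free variables. -/
def ReprBite (m : ℕ → ℕ) (ρ : ℕ → ℕ) : Bite → ℕ → Prop
  | .app x y, a => m (a + 1) = 0 ∧ m (a + 2) = ρ x ∧ m (a + 3) = ρ y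
  | .ret x y, a =>
      m (a + 1) = 1 ∧ m (a + 3) = Function.update ρ x (m (a + 2)) y ∧
        (∀ w ∈ Bite.fv (.ret x y), ρ w ≠ m (a + 2))
  | .lam x E, a =>
      m (a + 1) = 2 ∧ ∃ as : List ℕ, Linked m (m (a + 3)) as.reverse ∧
        (m (a + 2) :: as).Nodup ∧ (∀ w ∈ Bite.fv (.lam x E), ρ w ∉ m (a + 2) :: as) ∧
        ReprEnv m (bind (Function.update ρ x (m (a + 2))) E as) E as
/-- The bites of the environment are, from left to right, those of the nodes in the list. -/
def ReprEnv (m : ℕ → ℕ) (ρ : ℕ → ℕ) : Env → List ℕ → Prop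
  | [], as => as = []
  | (_, b) :: E, as => ∃ a as', as = a :: as' ∧ ReprBite m ρ b a ∧ ReprEnv m ρ E as'
end

/-- The history stack is a linked list of triples of cells: a link to the rest of the stack, and
then `0`, `0` for `⟨⟩`, and the addresses of `x` and `y` for `⟨x, y⟩`. -/
def ReprHist (m : ℕ → ℕ) (ρ : ℕ → ℕ) : List HistEntry → ℕ → Prop
  | [], h => h = 0
  | none :: H, h => h ≠ 0 ∧ m (h + 1) = 0 ∧ m (h + 2) = 0 ∧ ReprHist m ρ H (m h)
  | some (x, y) :: H, h =>
      h ≠ 0 ∧ m (h + 1) = ρ x ∧ m (h + 2) = ρ y ∧ ReprHist m ρ H (m h)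

/-- The memory represents the state: cell `0` is a pointer to the rightmost node of the active
environment, cell `1` to the leftmost node of the evaluated environment, and cell `2` to the
history stack. -/
def Represents (m : ℕ → ℕ) (S : State) : Prop :=
  ∃ (as bs : List ℕ) (ρ : ℕ → ℕ),
    (as ++ bs).Nodup ∧ ρ = bind (fun _ => 0) (S.act ++ S.ev) (as ++ bs) ∧
    Linked m (m 0) as.reverse ∧ Linked m (m 1) bs ∧
    ReprEnv m ρ S.act as ∧ ReprEnv m ρ S.ev bs ∧ ReprHist m ρ S.hist (m 2)

/-! ### The initial memory

The nodes of an environment are laid out from left to right.  The node of an abstraction is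
directly followed by its block: a cell that stands for the bound variable and that contains the
address of the last cell of the block, and then the body. -/

mutual
/-- Number of cells in the block of a bite. -/
def Bite.blockLength : Bite → ℕ
  | .app _ _ => 0
  | .ret _ _ => 1
  | .lam _ E => 1 + Env.cellLength E
/-- Number of cells that an environment takes. -/
def Env.cellLength : Env → ℕ
  | [] => 0
  | (_, b) :: E => 4 + Bite.blockLength b + Env.cellLength E
end

/-- The addresses of the nodes of an environment that is laid out from address `a`. -/
def Env.nodes : ℕ → Env → List ℕ
  | _, [] => []
  | a, (_, b) :: E => a :: Env.nodes (a + 4 + b.blockLength) E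

mutual
/-- The cells, from cell `a + 1` onwards, of the node at `a` that contains the bite, and of its
block. -/
def Bite.cells (ρ : ℕ → ℕ) (a : ℕ) : Bite → List ℕ
  | .app x y => [0, ρ x, ρ y]
  | .ret x y => [1, a + 4, Function.update ρ x (a + 4) y, a + 4]
  | .lam x E =>
      [2, a + 4, (Env.nodes (a + 5) E).getLastD 0, a + 4 + Env.cellLength E] ++
        Env.cells (bind (Function.update ρ x (a + 4)) E (Env.nodes (a + 5) E)) 0 (a + 5) E
/-- The cells of an environment laid out from address `a`, where the leftmost node is linked
to `prev`. -/
def Env.cells (ρ : ℕ → ℕ) (prev a : ℕ) : Env → List ℕ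
  | [] => []
  | (_, b) :: E =>
      prev :: (Bite.cells ρ a b ++ Env.cells ρ a (a + 4 + Bite.blockLength b) E)
end

/-- The initial memory for `ι(E)`: cells `0`, `1`, `2` are the pointers to the active environment,
to the (empty) evaluated environment and to the (empty) history stack, cell `3` contains the first
unused address, and `k` further working cells are followed by the environment `E`.  All other cells
contain `0`. -/
def initMem (k : ℕ) (E : Env) : ℕ → ℕ := fun i =>
  ([(Env.nodes (k + 4) E).getLastD 0, 0, 0, k + 4 + Env.cellLength E] ++ List.replicate k 0 ++
    Env.cells (bind (fun _ => 0) E (Env.nodes (k + 4) E)) 0 (k + 4) E).getD i 0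

/-! ### Implementing an execution -/

/-- The program `P`, started in configuration `s`, passes successively through representations of
all the states of the execution, the last of them after exactly `T` steps. -/
def Implements (P : Program) (s : Config) {S₀ : State} : {S : State} → Execution S₀ S → ℕ → Prop
  | _, .refl, T => Represents (P.run s T).mem S₀
  | S', .tail ρ _ _, T =>
      (∃ T' < T, Implements P s ρ T') ∧ Represents (P.run s T).mem S'

end RCAM

/-!
The program `machine` keeps the explicit substitutions of the active and of the evaluated
environment in nodes, relinks a node when its bite has been evaluated, and performs the two
principal transitions by copying: a returned value is shared, by copying the three cells that
describe it, while the body of an abstraction is copied cell by cell.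

Copying a body needs neither parsing nor recursion.  The block of an abstraction occupies
consecutive cells `s, …, e`, and everything that depends on its position is an address in that
interval; the names that are free in it have addresses elsewhere, and the tags `0`, `1`, `2` are
smaller than all such addresses.  Hence one map on cell contents, `relocate`, turns a block into a
block of the renamed and substituted body: it moves the addresses of the interval by a constant,
except that `s`, which stands for the bound variable, becomes the address of the argument, and that
`s + 1`, the leftmost node of the body, becomes the node of the application.  This is
`cells_rename`, and for the transition `m1` it is `copied_body`: the layout of a bite depends on
its names only through their addresses, so that renaming defined variables apart costs nothing.
It requires that nothing is captured, which follows from the syntactic invariant `Good`: the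
variables that the state defines are never bound inside a bite.

The memory invariant is `Layout`.  It demands of each node that it contains the first three cells
of an ideal layout `Bite.cells`, and that the rest of this layout lies in `Frozen` cells, which are
in use but belong to no node of the state.  No transition writes to a frozen cell, so the sharing
of blocks between nodes is harmless, and so is the fact that the block of a bite may be far away
from its node.  `Layout.represents` shows that the invariant implies `Represents`; the lemmas
`Layout.move` and `Layout.enter` show that it is preserved.

As for time, every body in a reachable state is a renamed body of the initial environment, so a
block has at most `N` cells, where `N` is the number of cells of the crumbled term, which is linear
in the size of the term (`CrumbSpec`).  A principal transition therefore takes time `O(N)` and adds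
at most `N` entries to the active environment.  A search transition takes constant time and removes
an entry, so that the length of the active environment is a potential that pays for all search
transitions (`simulates_step`).
-/

namespace RCAM

/-! ### Syntax: bound names, free occurrences, and renaming -/

/-- Induction on bites and environments simultaneously. -/
theorem Bite.induction_env {P : Bite → Prop} {Q : Env → Prop}
    (app : ∀ x y, P (.app x y)) (ret : ∀ x y, P (.ret x y))
    (lam : ∀ x E, Q E → P (.lam x E)) (nil : Q [])
    (cons : ∀ z b E, P b → Q E → Q ((z, b) :: E)) : (∀ b, P b) ∧ ∀ E, Q E :=
  ⟨fun b => Bite.rec (motive_1 := P) (motive_2 := Q) (motive_3 := fun e => P e.2)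
      app ret lam nil (fun e E he hE => cons e.1 e.2 E he hE) (fun _ _ h => h) b,
    fun E => Bite.rec_1 (motive_1 := P) (motive_2 := Q) (motive_3 := fun e => P e.2)
      app ret lam nil (fun e E he hE => cons e.1 e.2 E he hE) (fun _ _ h => h) E⟩

mutual
/-- The names that are bound inside a bite: by an abstraction or by an entry of a body. -/
def Bite.bn : Bite → Finset ℕ
  | .app _ _ => ∅
  | .ret x _ => {x}
  | .lam x E => insert x (Env.dom E ∪ Env.bn E)
/-- The names that are bound inside the bites of an environment. -/
def Env.bn : Env → Finset ℕ
  | [] => ∅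
  | (_, b) :: E => Bite.bn b ∪ Env.bn E
end

mutual
/-- The free variables of a bite, where the scope of an entry of a body is the whole body.  This
agrees with the scope that `Env.rename` and `bind` use. -/
def Bite.occ : Bite → Finset ℕ
  | .app x y => {x, y}
  | .ret x y => ({y} : Finset ℕ).erase x
  | .lam x E => (Env.occ E \ Env.dom E).erase x
/-- The union of the free variables of the bites of an environment. -/
def Env.occ : Env → Finset ℕ
  | [] => ∅
  | (_, b) :: E => Bite.occ b ∪ Env.occ E
end

/-- The names that the entries of an environment define, in order and with repetitions. -/
def Env.domList (E : Env) : List ℕ := E.filterMap Prod.fst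

mutual
/-- No body inside the bite defines a name twice. -/
def Bite.WF : Bite → Prop
  | .app _ _ => True
  | .ret _ _ => True
  | .lam _ E => (Env.domList E).Nodup ∧ Env.WF E
/-- No body inside the bites of the environment defines a name twice. -/
def Env.WF : Env → Prop
  | [] => True
  | (_, b) :: E => Bite.WF b ∧ Env.WF E
end

theorem Env.mem_dom {E : Env} {w : ℕ} : w ∈ Env.dom E ↔ ∃ b, (some w, b) ∈ E := by
  simp [Env.dom]

theorem Env.mem_domList {E : Env} {w : ℕ} : w ∈ Env.domList E ↔ w ∈ Env.dom E := by
  simp [Env.dom, Env.domList]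

@[simp] theorem Env.dom_nil : Env.dom [] = ∅ := rfl

theorem Env.dom_cons (z : Option ℕ) (b : Bite) (E : Env) :
    Env.dom ((z, b) :: E) = z.toFinset ∪ Env.dom E := by
  ext w; cases z <;> simp [Env.dom]

theorem Env.dom_append (E F : Env) : Env.dom (E ++ F) = Env.dom E ∪ Env.dom F := by
  simp [Env.dom]

theorem Env.domList_cons (z : Option ℕ) (b : Bite) (E : Env) :
    Env.domList ((z, b) :: E) = z.toList ++ Env.domList E := by
  cases z <;> simp [Env.domList]

theorem Env.domList_append (E F : Env) :
    Env.domList (E ++ F) = Env.domList E ++ Env.domList F := by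
  simp [Env.domList]

theorem Env.mem_bn {E : Env} {w : ℕ} : w ∈ Env.bn E ↔ ∃ e ∈ E, w ∈ Bite.bn e.2 := by
  induction E with
  | nil => simp [Env.bn]
  | cons e E ih => obtain ⟨z, b⟩ := e; simp [Env.bn, ih]

theorem Env.mem_occ {E : Env} {w : ℕ} : w ∈ Env.occ E ↔ ∃ e ∈ E, w ∈ Bite.occ e.2 := by
  induction E with
  | nil => simp [Env.occ]
  | cons e E ih => obtain ⟨z, b⟩ := e; simp [Env.occ, ih]

theorem Env.wf_iff {E : Env} : Env.WF E ↔ ∀ e ∈ E, Bite.WF e.2 := by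
  induction E with
  | nil => simp [Env.WF]
  | cons e E ih => obtain ⟨z, b⟩ := e; simp [Env.WF, ih]

theorem Env.mem_names {E : Env} {w : ℕ} :
    w ∈ Env.names E ↔ w ∈ Env.dom E ∨ ∃ e ∈ E, w ∈ Bite.names e.2 := by
  induction E with
  | nil => simp [Env.names]
  | cons e E ih =>
    obtain ⟨z, b⟩ := e
    simp only [Env.names, Finset.mem_union, ih, Env.dom_cons, List.mem_cons, exists_eq_or_imp]
    tauto

theorem Env.dom_subset_names (E : Env) : Env.dom E ⊆ Env.names E := fun _ hw =>
  Env.mem_names.2 (Or.inl hw)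

theorem bn_subset_names :
    (∀ b : Bite, Bite.bn b ⊆ Bite.names b) ∧ ∀ E : Env, Env.bn E ⊆ Env.names E := by
  apply Bite.induction_env
  · simp [Bite.bn]
  · simp [Bite.bn, Bite.names]
  · intro x E ih
    have := Env.dom_subset_names E
    simp only [Bite.bn, Bite.names]
    exact Finset.insert_subset_insert _ (Finset.union_subset this ih)
  · simp [Env.bn]
  · intro z b E hb hE
    simp only [Env.bn, Env.names]
    intro w hw
    simp only [Finset.mem_union] at hw ⊢
    rcases hw with hw | hw
    · exact Or.inl (Or.inr (hb hw))
    · exact Or.inr (hE hw)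

/-! Renaming does not change the entries' variables, the bound names, or any length. -/

theorem Env.rename_eq_map (θ : ℕ → ℕ) (E : Env) :
    Env.rename θ E = E.map fun e => (e.1, Bite.rename θ e.2) := by
  induction E with
  | nil => simp [Env.rename]
  | cons e E ih => obtain ⟨z, b⟩ := e; simp [Env.rename, ih]

theorem Env.domList_rename (θ : ℕ → ℕ) (E : Env) :
    Env.domList (Env.rename θ E) = Env.domList E := by
  rw [Env.rename_eq_map]
  simp [Env.domList, List.filterMap_map]

theorem Env.dom_rename (θ : ℕ → ℕ) (E : Env) : Env.dom (Env.rename θ E) = Env.dom E := by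
  ext w; rw [← Env.mem_domList, Env.domList_rename, Env.mem_domList]

/-- Renaming does not touch bound names, so the set of bound names of a state never grows. -/
theorem bn_rename :
    (∀ (b : Bite) (θ : ℕ → ℕ), Bite.bn (Bite.rename θ b) = Bite.bn b) ∧
      ∀ (E : Env) (θ : ℕ → ℕ), Env.bn (Env.rename θ E) = Env.bn E := by
  apply Bite.induction_env <;> intros <;>
    simp_all [Bite.rename, Bite.bn, Env.bn, Env.rename, Env.dom_rename]

theorem wf_rename :
    (∀ (b : Bite) (θ : ℕ → ℕ), Bite.WF (Bite.rename θ b) ↔ Bite.WF b) ∧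
      ∀ (E : Env) (θ : ℕ → ℕ), Env.WF (Env.rename θ E) ↔ Env.WF E := by
  apply Bite.induction_env <;> intros <;>
    simp_all [Bite.rename, Bite.WF, Env.WF, Env.rename, Env.domList_rename]

theorem length_rename :
    (∀ (b : Bite) (θ : ℕ → ℕ), Bite.blockLength (Bite.rename θ b) = Bite.blockLength b) ∧
      ∀ (E : Env) (θ : ℕ → ℕ), Env.cellLength (Env.rename θ E) = Env.cellLength E := by
  apply Bite.induction_env <;> intros <;>
    simp_all [Bite.rename, Bite.blockLength, Env.cellLength, Env.rename]

/-- With this notion of free variable no assumption that `θ` captures nothing is needed. -/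
theorem occ_rename :
    (∀ (b : Bite) (θ : ℕ → ℕ), Bite.occ (Bite.rename θ b) ⊆ (Bite.occ b).image θ) ∧
      ∀ (E : Env) (θ : ℕ → ℕ), Env.occ (Env.rename θ E) ⊆ (Env.occ E).image θ := by
  apply Bite.induction_env
  · intro x y θ; simp [Bite.rename, Bite.occ]
  · intro x y θ w
    by_cases h : y = x <;> simp +contextual [Bite.rename, Bite.occ, h]
  · intro x E ih θ w hw
    simp only [Bite.rename, Bite.occ, Finset.mem_erase, Finset.mem_sdiff, Env.dom_rename] at hw
    obtain ⟨hx, ho, hd⟩ := hw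
    have := ih _ ho
    simp only [Finset.mem_image] at this ⊢
    obtain ⟨v, hv, rfl⟩ := this
    split_ifs at * with h
    · tauto
    · push Not at h
      exact ⟨v, by simp [Bite.occ, h, hv], rfl⟩
  · simp [Env.rename, Env.occ]
  · intro z b E hb hE θ
    simp only [Env.rename, Env.occ, Finset.image_union]
    exact Finset.union_subset_union (hb θ) (hE θ)

theorem rename_id :
    (∀ b : Bite, Bite.rename id b = b) ∧ ∀ E : Env, Env.rename id E = E := by
  apply Bite.induction_env <;> intros <;> simp_all [Bite.rename, Env.rename]
  · rename_i x E ih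
    conv_rhs => rw [← ih]
    rfl

theorem Env.domList_renameDom (α : ℕ → ℕ) (E : Env) :
    Env.domList (Env.renameDom α E) = (Env.domList E).map α := by
  simp only [Env.renameDom, Env.rename_eq_map, Env.domList, List.map_map]
  induction E with
  | nil => rfl
  | cons e E ih => obtain ⟨z, b⟩ := e; cases z <;> simp_all

/-! ### Addresses of names -/

theorem bind_of_notMem {ρ : ℕ → ℕ} {w : ℕ} : ∀ {E : Env} (as : List ℕ), w ∉ Env.dom E →
    bind ρ E as w = ρ w
  | [], as, _ => by simp [bind]
  | (none, b) :: E, [], h => by simp [bind]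
  | (some z, b) :: E, [], h => by simp [bind]
  | (none, b) :: E, a :: as, h => by
      simp only [Env.dom_cons, Finset.mem_union, not_or] at h
      simp [bind, bind_of_notMem as h.2]
  | (some z, b) :: E, a :: as, h => by
      simp only [Env.dom_cons, Finset.mem_union, not_or] at h
      have : w ≠ z := by simpa using h.1
      simp [bind, this, bind_of_notMem as h.2]

theorem bind_mem {ρ : ℕ → ℕ} {w : ℕ} : ∀ {E : Env} {as : List ℕ}, w ∈ Env.dom E →
    E.length = as.length → bind ρ E as w ∈ as
  | [], as, h, _ => by simp at h
  | e :: E, [], h, h' => by simp at h'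
  | (none, b) :: E, a :: as, h, h' => by
      simp only [Env.dom_cons, Option.toFinset_none, Finset.empty_union] at h
      simp only [bind, List.mem_cons]
      exact Or.inr (bind_mem h (by simpa using h'))
  | (some z, b) :: E, a :: as, h, h' => by
      simp only [bind, List.mem_cons, Function.update_apply]
      split_ifs with hw
      · exact Or.inl rfl
      · simp only [Env.dom_cons, Option.toFinset_some, Finset.mem_union, Finset.mem_singleton,
          hw, false_or] at h
        exact Or.inr (bind_mem h (by simpa using h'))

/-- Moving the nodes moves the addresses of the names that an environment defines. -/
theorem bind_map {ρ ρ' g : ℕ → ℕ} {w : ℕ} : ∀ {E : Env} {as : List ℕ}, w ∈ Env.dom E →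
    E.length = as.length → bind ρ' E (as.map g) w = g (bind ρ E as w)
  | [], as, h, _ => by simp at h
  | e :: E, [], h, h' => by simp at h'
  | (none, b) :: E, a :: as, h, h' => by
      simp only [Env.dom_cons, Option.toFinset_none, Finset.empty_union] at h
      simp only [bind, List.map_cons]
      exact bind_map h (by simpa using h')
  | (some z, b) :: E, a :: as, h, h' => by
      simp only [bind, List.map_cons, Function.update_apply]
      split_ifs with hw
      · rfl
      · simp only [Env.dom_cons, Option.toFinset_some, Finset.mem_union, Finset.mem_singleton,
          hw, false_or] at h
        exact bind_map h (by simpa using h')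

/-- Renaming the names that an environment defines renames the argument of `bind`. -/
theorem bind_map_names {ρ ρ' α : ℕ → ℕ} {w : ℕ} : ∀ {E : Env} {as : List ℕ},
    w ∈ Env.dom E → Set.InjOn α (Env.dom E) → E.length = as.length →
    bind ρ' (E.map fun e => (e.1.map α, e.2)) as (α w) = bind ρ E as w
  | [], as, h, _, _ => by simp at h
  | e :: E, [], h, _, h' => by simp at h'
  | (none, b) :: E, a :: as, h, hα, h' => by
      simp only [Env.dom_cons, Option.toFinset_none, Finset.empty_union] at h hα
      simp only [bind, List.map_cons, Option.map_none]
      exact bind_map_names h hα (by simpa using h')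
  | (some z, b) :: E, a :: as, h, hα, h' => by
      simp only [bind, List.map_cons, Option.map_some, Function.update_apply]
      have hw' : α w = α z ↔ w = z :=
        hα.eq_iff h (by simp [Env.dom_cons])
      simp only [hw']
      split_ifs with hw
      · rfl
      · simp only [Env.dom_cons, Option.toFinset_some, Finset.mem_union, Finset.mem_singleton,
          hw, false_or] at h
        refine bind_map_names h (hα.mono ?_) (by simpa using h')
        simp [Env.dom_cons]

theorem bind_congr {ρ : ℕ → ℕ} : ∀ {E F : Env} (as : List ℕ),
    E.map Prod.fst = F.map Prod.fst → bind ρ E as = bind ρ F as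
  | [], [], _, _ => rfl
  | [], _ :: _, _, h => by simp at h
  | _ :: _, [], _, h => by simp at h
  | e :: E, f :: F, [], h => by
      obtain ⟨z, b⟩ := e; obtain ⟨z', b'⟩ := f
      cases z <;> cases z' <;> simp [bind]
  | (z, b) :: E, (z', b') :: F, a :: as, h => by
      simp only [List.map_cons, List.cons.injEq] at h
      obtain ⟨rfl, h⟩ := h
      cases z <;> simp [bind, bind_congr as h]

theorem bind_append {ρ : ℕ → ℕ} {F : Env} {bs : List ℕ} : ∀ {E : Env} {as : List ℕ},
    E.length = as.length → bind ρ (E ++ F) (as ++ bs) = bind (bind ρ F bs) E as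
  | [], [], _ => by simp [bind]
  | [], _ :: _, h => by simp at h
  | _ :: _, [], h => by simp at h
  | (z, b) :: E, a :: as, h => by
      have ih := bind_append (ρ := ρ) (F := F) (bs := bs) (E := E) (as := as) (by simpa using h)
      cases z <;> simp [bind, ih]

/-! ### The layout of environments in memory -/

theorem length_nodes : ∀ (a : ℕ) (E : Env), (Env.nodes a E).length = E.length
  | _, [] => rfl
  | a, (_, b) :: E => by simp [Env.nodes, length_nodes _ E]

theorem nodes_bounds {n : ℕ} : ∀ {a : ℕ} {E : Env}, n ∈ Env.nodes a E →
    a ≤ n ∧ n + 4 ≤ a + Env.cellLength E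
  | _, [], h => by simp [Env.nodes] at h
  | a, (_, b) :: E, h => by
      simp only [Env.nodes, List.mem_cons] at h
      simp only [Env.cellLength]
      rcases h with rfl | h
      · omega
      · have := nodes_bounds h
        omega

theorem nodes_pairwise : ∀ (a : ℕ) (E : Env), (Env.nodes a E).Pairwise fun p q => p + 4 ≤ q
  | _, [] => by simp [Env.nodes]
  | a, (_, b) :: E => by
      simp only [Env.nodes, List.pairwise_cons]
      refine ⟨fun n hn => ?_, nodes_pairwise _ E⟩
      have := nodes_bounds hn
      omega

theorem nodes_shift (θ : ℕ → ℕ) (δ : ℕ) : ∀ (a : ℕ) (E : Env),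
    Env.nodes (a + δ) (Env.rename θ E) = (Env.nodes a E).map (· + δ)
  | _, [] => by simp [Env.nodes, Env.rename]
  | a, (z, b) :: E => by
      simp only [Env.nodes, Env.rename, List.map_cons, length_rename.1, ← nodes_shift θ δ _ E]
      congr 2
      omega

theorem length_cells :
    (∀ (b : Bite) (ρ : ℕ → ℕ) (a : ℕ), (Bite.cells ρ a b).length = 3 + Bite.blockLength b) ∧
      ∀ (E : Env) (ρ : ℕ → ℕ) (prev a : ℕ),
        (Env.cells ρ prev a E).length = Env.cellLength E := by
  apply Bite.induction_env
  · intros; simp [Bite.cells, Bite.blockLength]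
  · intros; simp [Bite.cells, Bite.blockLength]
  · intro x E ih ρ a; simp [Bite.cells, Bite.blockLength, ih]; omega
  · intros; simp [Env.cells, Env.cellLength]
  · intro z b E hb hE ρ prev a; simp [Env.cells, Env.cellLength, hb, hE]; omega

theorem map_getLastD {α β : Type*} (f : α → β) (d : α) :
    ∀ l : List α, (l.map f).getLastD (f d) = f (l.getLastD d)
  | [] => rfl
  | a :: l => by simp only [List.map_cons, List.getLastD_cons, map_getLastD f a l]

/-- Relocation: applied to all the cells of a laid out bite or environment, a map `f` that moves
the addresses of its block by `δ` yields the layout of a renaming `θ` of it, provided that `f`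
moves the addresses of names along `θ` and that `θ` captures nothing. -/
theorem cells_rename {f : ℕ → ℕ} {δ : ℕ} (h0 : f 0 = 0) (h1 : f 1 = 1) (h2 : f 2 = 2) :
    (∀ (b : Bite) (ρ ρ' θ : ℕ → ℕ) (a : ℕ),
      (∀ i, a + 4 ≤ i → i < a + 4 + Bite.blockLength b → f i = i + δ) →
      (∀ w ∈ Bite.names b, ρ' (θ w) = f (ρ w)) →
      (∀ w ∈ Bite.names b, θ w = w ∨ θ w ∉ Bite.bn b) →
      (Bite.cells ρ a b).map f = Bite.cells ρ' (a + δ) (Bite.rename θ b)) ∧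
    ∀ (E : Env) (ρ ρ' θ : ℕ → ℕ) (prev a : ℕ),
      (∀ i, a ≤ i → i < a + Env.cellLength E → f i = i + δ) →
      (∀ w ∈ Env.names E, ρ' (θ w) = f (ρ w)) →
      (∀ w ∈ Env.names E, θ w = w ∨ θ w ∉ Env.bn E) →
      (Env.cells ρ prev a E).map f = Env.cells ρ' (f prev) (a + δ) (Env.rename θ E) := by
  apply Bite.induction_env
  · intro x y ρ ρ' θ a _ hρ _
    simp [Bite.cells, Bite.rename, h0, hρ x (by simp [Bite.names]), hρ y (by simp [Bite.names])]
  · intro x y ρ ρ' θ a hf hρ hθ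
    have ha : f (a + 4) = a + δ + 4 := by
      rw [hf (a + 4) le_rfl (by simp [Bite.blockLength])]; omega
    simp only [Bite.cells, Bite.rename, List.map_cons, h1, ha, List.map_nil]
    by_cases hy : y = x
    · subst hy; simp [ha]
    · have h3 : θ y ≠ x := by
        rcases hθ y (by simp [Bite.names]) with h | h
        · rw [h]; exact hy
        · simpa [Bite.bn] using h
      simp [hy, h3, hρ y (by simp [Bite.names])]
  · intro x E ih ρ ρ' θ a hf hρ hθ
    simp only [Bite.blockLength] at hf
    have ha : f (a + 4) = a + δ + 4 := by rw [hf (a + 4) le_rfl (by omega)]; omega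
    have hl : f ((Env.nodes (a + 5) E).getLastD 0) =
        (Env.nodes (a + δ + 5) (Env.rename (fun w => if w = x ∨ w ∈ Env.dom E then w else θ w)
          E)).getLastD 0 := by
      rw [show a + δ + 5 = a + 5 + δ by omega, nodes_shift, ← map_getLastD f, h0]
      congr 1
      refine List.map_congr_left fun n hn => ?_
      have := nodes_bounds hn
      exact hf n (by omega) (by omega)
    have he : f (a + 4 + Env.cellLength E) = a + δ + 4 + Env.cellLength E := by
      rw [hf _ (by omega) (by omega)]; omega
    simp only [Bite.cells, Bite.rename, List.map_append, List.map_cons, List.map_nil, h2, ha, hl,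
      he, length_rename.2]
    congr 1
    rw [show a + δ + 5 = a + 5 + δ by omega]
    refine (ih _ (bind (Function.update ρ' x (a + δ + 4)) _ (Env.nodes (a + 5 + δ) _)) _ 0 (a + 5)
      (fun i hi hi' => hf i (by omega) (by omega)) ?_ ?_).trans (by rw [h0])
    · intro w hw
      rw [nodes_shift]
      by_cases hd : w ∈ Env.dom E
      · have hlen : E.length = (Env.nodes (a + 5) E).length := (length_nodes _ _).symm
        have hm := bind_mem (ρ := Function.update ρ x (a + 4)) hd hlen
        have hb := nodes_bounds hm
        rw [if_pos (Or.inr hd), hf _ (by omega) (by omega)]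
        rw [bind_map (ρ := Function.update ρ x (a + 4)) (by rwa [Env.dom_rename])
          (by simpa [Env.rename_eq_map] using hlen)]
        congr 1
        refine congrFun (bind_congr _ ?_) w
        simp [Env.rename_eq_map]
      · rw [bind_of_notMem _ hd]
        by_cases hx : w = x
        · subst hx
          rw [if_pos (Or.inl rfl), bind_of_notMem _ (by rwa [Env.dom_rename])]
          simp only [Function.update_self]
          omega
        · rw [if_neg (by tauto)]
          have hw' : w ∈ Bite.names (.lam x E) := by simp [Bite.names, hw]
          have h3 : θ w ≠ x ∧ θ w ∉ Env.dom E := by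
            rcases hθ w hw' with h | h
            · rw [h]; exact ⟨hx, hd⟩
            · simp only [Bite.bn, Finset.mem_insert, Finset.mem_union, not_or] at h
              exact ⟨h.1, h.2.1⟩
          rw [bind_of_notMem _ (by rw [Env.dom_rename]; exact h3.2),
            Function.update_of_ne h3.1, Function.update_of_ne hx]
          exact hρ w hw'
    · intro w hw
      split_ifs with h
      · exact Or.inl rfl
      · rcases hθ w (by simp [Bite.names, hw]) with h | h
        · exact Or.inl h
        · simp only [Bite.bn, Finset.mem_insert, Finset.mem_union, not_or] at h
          exact Or.inr h.2.2
  · intros; simp [Env.cells, Env.rename]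
  · intro z b E hb hE ρ ρ' θ prev a hf hρ hθ
    simp only [Env.cellLength] at hf
    simp only [Env.names, Finset.mem_union] at hρ hθ
    have ha : f a = a + δ := hf a le_rfl (by omega)
    simp only [Env.cells, Env.rename, List.map_cons, List.map_append, length_rename.1]
    rw [hb ρ ρ' θ a (fun i hi hi' => hf i (by omega) (by omega))
        (fun w hw => hρ w (Or.inl (Or.inr hw)))
        (fun w hw => (hθ w (Or.inl (Or.inr hw))).imp id fun h h' => h (by simp [Env.bn, h'])),
      hE ρ ρ' θ a (a + 4 + Bite.blockLength b) (fun i hi hi' => hf i (by omega) (by omega))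
        (fun w hw => hρ w (Or.inr hw))
        (fun w hw => (hθ w (Or.inr hw)).imp id fun h h' => h (by simp [Env.bn, h'])), ha]
    congr 3
    omega

/-- The layout of a bite depends on the addresses of its names only. -/
theorem cells_congr {b : Bite} {ρ ρ' : ℕ → ℕ} (a : ℕ) (h : ∀ w ∈ Bite.names b, ρ' w = ρ w) :
    Bite.cells ρ' a b = Bite.cells ρ a b := by
  have := (cells_rename (f := id) (δ := 0) rfl rfl rfl).1 b ρ ρ' id a (by simp) h (by simp)
  rw [rename_id.1] at this
  simpa using this.symm

theorem cells_map_names (g : Option ℕ → Option ℕ) (ρ : ℕ → ℕ) : ∀ (prev a : ℕ) (E : Env),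
    Env.cells ρ prev a (E.map fun e => (g e.1, e.2)) = Env.cells ρ prev a E
  | _, _, [] => rfl
  | prev, a, (z, b) :: E => by
      have := cells_map_names g ρ a (a + 4 + Bite.blockLength b) E
      simp [Env.cells, this]

/-! ### Contents of consecutive cells -/

/-- The memory contains the list in consecutive cells from address `a` onwards. -/
def ContainsAt (m : ℕ → ℕ) : ℕ → List ℕ → Prop
  | _, [] => True
  | a, v :: l => m a = v ∧ ContainsAt m (a + 1) l

theorem containsAt_append {m : ℕ → ℕ} {l' : List ℕ} : ∀ {l : List ℕ} {a : ℕ},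
    ContainsAt m a (l ++ l') ↔ ContainsAt m a l ∧ ContainsAt m (a + l.length) l'
  | [], a => by simp [ContainsAt]
  | v :: l, a => by
      simp only [List.cons_append, ContainsAt, containsAt_append (l := l), List.length_cons,
        and_assoc]
      rw [show a + 1 + l.length = a + (l.length + 1) by omega]

/-- Cells that are copied by `d` to the right, while `f` is applied to their contents. -/
theorem ContainsAt.map {m m' f : ℕ → ℕ} {d : ℕ} : ∀ {l : List ℕ} {a : ℕ}, ContainsAt m a l →
    (∀ i, a ≤ i → i < a + l.length → m' (i + d) = f (m i)) → ContainsAt m' (a + d) (l.map f)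
  | [], _, _, _ => trivial
  | v :: l, a, h, hm => by
      refine ⟨by rw [hm a le_rfl (by simp), h.1], ?_⟩
      have := ContainsAt.map (d := d) h.2 fun i hi hi' =>
        hm i (by omega) (by simp only [List.length_cons]; omega)
      rwa [show a + 1 + d = a + d + 1 by omega] at this

theorem ContainsAt.congr {m m' : ℕ → ℕ} {l : List ℕ} {a : ℕ} (h : ContainsAt m a l)
    (hm : ∀ i, a ≤ i → i < a + l.length → m' i = m i) : ContainsAt m' a l := by
  simpa using h.map (d := 0) (f := id) (m' := m') hm

theorem containsAt_of_getD {m : ℕ → ℕ} : ∀ {l : List ℕ} {a : ℕ},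
    (∀ i < l.length, m (a + i) = l.getD i 0) → ContainsAt m a l
  | [], _, _ => trivial
  | v :: l, a, h => by
      refine ⟨by simpa using h 0 (by simp), containsAt_of_getD fun i hi => ?_⟩
      have := h (i + 1) (by simpa using hi)
      simpa [add_assoc, add_comm 1] using this

/-! ### Linked lists -/

/-- The nodes `as` form a segment of a linked list that starts at `p` and continues at `q`. -/
def Segment (m : ℕ → ℕ) : ℕ → List ℕ → ℕ → Prop
  | p, [], q => p = q
  | p, a :: as, q => p = a ∧ a ≠ 0 ∧ Segment m (m a) as q

theorem linked_iff_segment {m : ℕ → ℕ} : ∀ {as : List ℕ} {p : ℕ},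
    Linked m p as ↔ Segment m p as 0
  | [], _ => Iff.rfl
  | _ :: as, _ => by simp [Linked, Segment, linked_iff_segment (as := as)]

theorem segment_append {m : ℕ → ℕ} {bs : List ℕ} {q : ℕ} : ∀ {as : List ℕ} {p : ℕ},
    Segment m p (as ++ bs) q ↔ ∃ r, Segment m p as r ∧ Segment m r bs q
  | [], _ => by simp [Segment]
  | _ :: as, _ => by simp [Segment, segment_append (as := as), and_assoc]

theorem Segment.congr {m m' : ℕ → ℕ} {q : ℕ} : ∀ {as : List ℕ} {p : ℕ}, Segment m p as q →
    (∀ n ∈ as, m' n = m n) → Segment m' p as q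
  | [], _, h, _ => h
  | a :: as, _, h, hm => by
      refine ⟨h.1, h.2.1, ?_⟩
      rw [hm a (by simp)]
      exact Segment.congr h.2.2 fun n hn => hm n (by simp [hn])

/-- A laid out environment is linked from right to left. -/
theorem segment_of_cells {m ρ : ℕ → ℕ} : ∀ {E : Env} {prev a : ℕ}, a ≠ 0 →
    ContainsAt m a (Env.cells ρ prev a E) →
    Segment m ((Env.nodes a E).getLastD prev) (Env.nodes a E).reverse prev
  | [], _, _, _, _ => by simp [Env.nodes, Segment]
  | (z, b) :: E, prev, a, ha, h => by
      simp only [Env.cells, ContainsAt, containsAt_append, length_cells.1] at h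
      obtain ⟨hp, -, h⟩ := h
      rw [show a + 1 + (3 + Bite.blockLength b) = a + 4 + Bite.blockLength b by omega] at h
      simp only [Env.nodes, List.reverse_cons, List.getLastD_cons]
      exact segment_append.2 ⟨a, segment_of_cells (by omega) h, rfl, ha, hp⟩

/-! ### Laid out bites are represented -/

/-- It suffices that no address of a name lies in the block: the addresses that occur inside a
layout are then distinct as `ReprBite` demands.  In the first part the block of the bite is laid
out as for a node at `a`, while the node itself is at `n`. -/
theorem repr_of_cells {m : ℕ → ℕ} :
    (∀ (b : Bite) (ρ : ℕ → ℕ) (a n : ℕ), ContainsAt m (n + 1) ((Bite.cells ρ a b).take 3) →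
      ContainsAt m (a + 4) ((Bite.cells ρ a b).drop 3) →
      (∀ w, ρ w < a + 4 ∨ a + 4 + Bite.blockLength b ≤ ρ w) → ReprBite m ρ b n) ∧
    ∀ (E : Env) (ρ : ℕ → ℕ) (prev a : ℕ), ContainsAt m a (Env.cells ρ prev a E) →
      (∀ w, ρ w < a ∨ a + Env.cellLength E ≤ ρ w ∨ ρ w ∈ Env.nodes a E) →
      ReprEnv m ρ E (Env.nodes a E) := by
  apply Bite.induction_env
  · intro x y ρ a n h _ _
    simpa [Bite.cells, ContainsAt, ReprBite] using h
  · intro x y ρ a n h _ hρ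
    simp only [Bite.cells, List.take_succ_cons, List.take_zero, ContainsAt, and_true] at h
    obtain ⟨h1, h2, h3⟩ := h
    simp only [ReprBite, h1, h2, h3, true_and]
    intro w _ hw
    have := hρ w
    simp only [Bite.blockLength] at this
    omega
  · intro x E ih ρ a n h h' hρ
    simp only [Bite.cells, List.cons_append, List.nil_append, List.take_succ_cons, List.take_zero,
      List.drop_succ_cons, List.drop_zero, ContainsAt, and_true] at h h'
    obtain ⟨h1, h2, h3⟩ := h
    obtain ⟨-, h'⟩ := h'
    simp only [Bite.blockLength] at hρ
    simp only [ReprBite, h1, h2, h3, true_and]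
    refine ⟨Env.nodes (a + 5) E, ?_, ?_, ?_, ih _ 0 _ h' fun w => ?_⟩
    · exact linked_iff_segment.2 (segment_of_cells (by omega) h')
    · refine List.nodup_cons.2 ⟨fun hn => ?_, ?_⟩
      · have := nodes_bounds hn
        omega
      · exact (nodes_pairwise _ E).imp fun h => by omega
    · intro w _ hw
      have := hρ w
      rcases List.mem_cons.1 hw with hw | hw
      · omega
      · have := nodes_bounds hw
        omega
    · by_cases hd : w ∈ Env.dom E
      · exact Or.inr (Or.inr (bind_mem hd (length_nodes _ _).symm))
      · rw [bind_of_notMem _ hd]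
        by_cases hx : w = x
        · subst hx; left; simp
        · rw [Function.update_of_ne hx]
          have := hρ w
          omega
  · intros; simp [ReprEnv, Env.nodes]
  · intro z b E hb hE ρ prev a h hρ
    simp only [Env.cells, ContainsAt, containsAt_append, length_cells.1] at h
    obtain ⟨-, h, h'⟩ := h
    rw [show a + 1 + (3 + Bite.blockLength b) = a + 4 + Bite.blockLength b by omega] at h'
    simp only [Env.cellLength, Env.nodes, List.mem_cons] at hρ
    simp only [ReprEnv, Env.nodes]
    refine ⟨a, _, rfl, hb ρ a a ?_ ?_ fun w => ?_, hE _ _ _ h' fun w => ?_⟩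
    · rw [← List.take_append_drop 3 (Bite.cells ρ a b), containsAt_append] at h
      exact h.1
    · rw [← List.take_append_drop 3 (Bite.cells ρ a b), containsAt_append] at h
      have h3 : ((Bite.cells ρ a b).take 3).length = 3 := by
        simp [length_cells.1]
      rw [h3] at h
      exact h.2
    · rcases hρ w with h | h | h | h
      · omega
      · omega
      · omega
      · have := nodes_bounds h
        omega
    · rcases hρ w with h | h | h | h
      · omega
      · omega
      · omega
      · exact Or.inr (Or.inr h)

/-! ### The program -/

/-- The program.  Cells `4` to `24` are its working cells.  Cell `22` always contains `0`, and is
used for unconditional jumps and for moves; cell `4` contains `1`.  For the rightmost active node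
`a`, cell `5` contains its link, cells `6`, `8`, `10` the addresses `a + 1`, `a + 2`, `a + 3`, and
cells `7`, `9`, `11` the contents of the latter.  For an application, cells `13`, `14`, `15`
describe the bite of the function (the tag is decreased by `1`).  For an abstraction with block
`s, …, e`, cell `14` contains `s`, cell `16` contains `e`, cell `17` the distance of the copy, and
cell `18` the index of the copy loop.  The numbers in the comments are those of the
instructions. -/
def machine : Program := [
  -- 0: decode the rightmost active node, or halt
  .jumpZero 0 90, .const 4 1, .load 5 0, .add 6 0 4, .load 7 6, .add 8 6 4, .load 9 8,
  .add 10 8 4, .load 11 10, .jumpZero 7 23,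
  -- 10: search
  .const 9 0, .const 11 0,
  -- 12: move the node to the evaluated environment
  .store 0 1, .add 1 0 22, .add 0 5 22,
  -- 15: push a history entry
  .store 3 2, .add 2 3 22, .add 3 3 4, .store 3 9, .add 3 3 4, .store 3 11, .add 3 3 4,
  .jumpZero 22 0,
  -- 23: decode the function of an application
  .add 12 9 4, .load 13 12, .add 12 12 4, .load 14 12, .add 12 12 4, .load 15 12, .sub 13 13 4,
  .jumpZero 13 73,
  -- 31: copy and relocate the block of an abstraction
  .load 16 14, .sub 17 3 14, .add 18 14 22,
  .sub 20 16 18, .jumpZero 20 56, .add 18 18 4, .load 19 18,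
  .sub 20 14 19, .jumpZero 20 41, .jumpZero 22 53, .sub 20 19 16, .jumpZero 20 44,
  .jumpZero 22 53, .sub 20 19 14, .jumpZero 20 50, .sub 20 20 4, .jumpZero 20 52,
  .add 19 19 17, .jumpZero 22 53, .add 19 11 22, .jumpZero 22 53, .add 19 0 22,
  .add 21 18 17, .store 21 19, .jumpZero 22 34,
  -- 56: copy the leftmost bite of the body into the node of the application
  .add 21 3 4, .add 21 21 4, .load 19 21, .store 6 19, .add 21 21 4, .load 19 21, .store 8 19,
  .add 21 21 4, .load 19 21, .store 10 19,
  .sub 20 15 14, .sub 20 20 4, .jumpZero 20 70, .add 0 15 17, .add 3 16 17, .add 3 3 4,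
  .jumpZero 22 15,
  -- 73: copy the value that an identity or constant function returns
  .sub 20 15 14, .sub 12 14 15, .add 20 20 12, .jumpZero 20 79, .add 12 15 22, .jumpZero 22 80,
  .add 12 11 22, .add 12 12 4, .load 19 12, .store 6 19, .add 12 12 4, .load 19 12, .store 8 19,
  .add 12 12 4, .load 19 12, .store 10 19, .jumpZero 22 12]

theorem run_add (P : Program) (s : Config) (n k : ℕ) :
    P.run s (n + k) = P.run (P.run s n) k := by
  rw [Program.run, Program.run, Program.run, add_comm n k, Function.iterate_add_apply]

/-- The map that the copy loop applies to the contents of a block `s, …, e`: it moves the addresses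
of the block by `d`, except that the bound variable becomes `y`, and that the leftmost node of the
body becomes `a`. -/
def relocate (s e d y a v : ℕ) : ℕ :=
  if v < s then v else if e < v then v else if v = s then y else if v = s + 1 then a else v + d

/-! ### Symbolic execution -/

/-- Within `N` steps, the program reaches a configuration with property `Q`. -/
def Reaches (c : Config) (N : ℕ) (Q : Config → Prop) : Prop := ∃ n ≤ N, Q (machine.run c n)

section Reaches
variable {Q : Config → Prop} {m : ℕ → ℕ} {pc N : ℕ}

theorem Reaches.refl {c : Config} (h : Q c) : Reaches c N Q := ⟨0, by omega, h⟩

theorem Reaches.trans {c : Config} {N' : ℕ} {R : Config → Prop} (h : Reaches c N R)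
    (h' : ∀ c', R c' → Reaches c' N' Q) : Reaches c (N + N') Q := by
  obtain ⟨n, hn, hR⟩ := h
  obtain ⟨n', hn', hQ⟩ := h' _ hR
  exact ⟨n + n', by omega, by rwa [run_add]⟩

theorem Reaches.of_step {c c' : Config} (hc : machine.step c = c') (h : Reaches c' N Q) :
    Reaches c (N + 1) Q := by
  obtain ⟨n, hn, hQ⟩ := h
  refine ⟨n + 1, by omega, ?_⟩
  subst hc
  exact hQ

/-! For each instruction, it suffices to continue from an arbitrary memory that is only known to
differ from the old one as the instruction says. -/

theorem reaches_const {d k : ℕ} (hi : machine[pc]? = some (.const d k))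
    (h : ∀ m' : ℕ → ℕ, m' d = k → (∀ i, i ≠ d → m' i = m i) → Reaches ⟨pc + 1, m'⟩ N Q) :
    Reaches ⟨pc, m⟩ (N + 1) Q :=
  .of_step (by simp only [Program.step, hi]; rfl)
    (h (Function.update m d k) (by simp) fun i hi => by simp [hi])

theorem reaches_add {d a b : ℕ} (hi : machine[pc]? = some (.add d a b))
    (h : ∀ m' : ℕ → ℕ, m' d = m a + m b → (∀ i, i ≠ d → m' i = m i) →
      Reaches ⟨pc + 1, m'⟩ N Q) :
    Reaches ⟨pc, m⟩ (N + 1) Q :=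
  .of_step (by simp only [Program.step, hi]; rfl)
    (h (Function.update m d (m a + m b)) (by simp) fun i hi => by simp [hi])

theorem reaches_sub {d a b : ℕ} (hi : machine[pc]? = some (.sub d a b))
    (h : ∀ m' : ℕ → ℕ, m' d = m a - m b → (∀ i, i ≠ d → m' i = m i) →
      Reaches ⟨pc + 1, m'⟩ N Q) :
    Reaches ⟨pc, m⟩ (N + 1) Q :=
  .of_step (by simp only [Program.step, hi]; rfl)
    (h (Function.update m d (m a - m b)) (by simp) fun i hi => by simp [hi])

theorem reaches_load {d a : ℕ} (hi : machine[pc]? = some (.load d a))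
    (h : ∀ m' : ℕ → ℕ, m' d = m (m a) → (∀ i, i ≠ d → m' i = m i) →
      Reaches ⟨pc + 1, m'⟩ N Q) :
    Reaches ⟨pc, m⟩ (N + 1) Q :=
  .of_step (by simp only [Program.step, hi]; rfl)
    (h (Function.update m d (m (m a))) (by simp) fun i hi => by simp [hi])

theorem reaches_store {d a : ℕ} (hi : machine[pc]? = some (.store d a))
    (h : ∀ m' : ℕ → ℕ, m' (m d) = m a → (∀ i, i ≠ m d → m' i = m i) →
      Reaches ⟨pc + 1, m'⟩ N Q) :
    Reaches ⟨pc, m⟩ (N + 1) Q :=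
  .of_step (by simp only [Program.step, hi]; rfl)
    (h (Function.update m (m d) (m a)) (by simp) fun i hi => by simp [hi])

theorem reaches_jump {i l : ℕ} (hi : machine[pc]? = some (.jumpZero i l)) (h0 : m i = 0)
    (h : Reaches ⟨l, m⟩ N Q) : Reaches ⟨pc, m⟩ (N + 1) Q :=
  .of_step (by simp [Program.step, hi, Instr.exec, h0]) h

theorem reaches_pass {i l : ℕ} (hi : machine[pc]? = some (.jumpZero i l)) (h0 : m i ≠ 0)
    (h : Reaches ⟨pc + 1, m⟩ N Q) : Reaches ⟨pc, m⟩ (N + 1) Q :=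
  .of_step (by simp [Program.step, hi, Instr.exec, h0]) h

end Reaches

/-- The branches inside the copy loop compute `relocate`. -/
theorem reaches_relocate (m : ℕ → ℕ) (h22 : m 22 = 0) (h4 : m 4 = 1) :
    Reaches ⟨38, m⟩ 12 fun c => c.pc = 53 ∧
      c.mem 19 = relocate (m 14) (m 16) (m 17) (m 11) (m 0) (m 19) ∧
      ∀ i, i ≠ 19 → i ≠ 20 → c.mem i = m i := by
  unfold relocate
  split_ifs with c1 c2 c3 c4
  · have : m 14 - m 19 ≠ 0 := by omega
    refine ⟨3, by omega, ?_⟩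
    simp +contextual [Program.run, Program.step, machine, Instr.exec, this, h22]
  · have h1 : m 14 - m 19 = 0 := by omega
    have h2 : m 19 - m 16 ≠ 0 := by omega
    refine ⟨5, by omega, ?_⟩
    simp +contextual [Program.run, Program.step, machine, Instr.exec, h1, h2, h22]
  · have h1 : m 14 - m 19 = 0 := by omega
    have h2 : m 19 - m 16 = 0 := by omega
    have h3 : m 19 - m 14 = 0 := by omega
    refine ⟨8, by omega, ?_⟩
    simp +contextual [Program.run, Program.step, machine, Instr.exec, h1, h2, h3, h22]
  · have h1 : m 14 - m 19 = 0 := by omega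
    have h2 : m 19 - m 16 = 0 := by omega
    have h3 : m 19 - m 14 = 1 := by omega
    refine ⟨9, by omega, ?_⟩
    simp +contextual [Program.run, Program.step, machine, Instr.exec, h1, h2, h3, h4, h22]
  · have h1 : m 14 - m 19 = 0 := by omega
    have h2 : m 19 - m 16 = 0 := by omega
    have h3 : m 19 - m 14 ≠ 0 := by omega
    have h5 : m 19 - m 14 - 1 ≠ 0 := by omega
    refine ⟨10, by omega, ?_⟩
    simp +contextual [Program.run, Program.step, machine, Instr.exec, h1, h2, h3, h4, h5, h22]

/-- Instructions `1` to `8`, which decode the rightmost active node. -/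
theorem reaches_decode {Q : Config → Prop} {N : ℕ} {m : ℕ → ℕ} (h0 : 25 ≤ m 0)
    (h : ∀ m' : ℕ → ℕ, m' 4 = 1 → m' 5 = m (m 0) → m' 6 = m 0 + 1 →
      m' 7 = m (m 0 + 1) → m' 8 = m 0 + 2 → m' 9 = m (m 0 + 2) → m' 10 = m 0 + 3 →
      m' 11 = m (m 0 + 3) → (∀ i, (i < 4 ∨ 22 ≤ i) → m' i = m i) → Reaches ⟨9, m'⟩ N Q) :
    Reaches ⟨1, m⟩ (N + 8) Q := by
  refine reaches_const rfl fun m1 a1 b1 => ?_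
  refine reaches_load rfl fun m2 a2 b2 => ?_
  refine reaches_add rfl fun m3 a3 b3 => ?_
  refine reaches_load rfl fun m4 a4 b4 => ?_
  refine reaches_add rfl fun m5 a5 b5 => ?_
  refine reaches_load rfl fun m6 a6 b6 => ?_
  refine reaches_add rfl fun m7 a7 b7 => ?_
  refine reaches_load rfl fun m8 a8 b8 => ?_
  refine h _ ?_ ?_ ?_ ?_ ?_ ?_ ?_ ?_ fun i hi => ?_
  all_goals
    simp (disch := omega) only [a1, a2, a3, a4, a5, a6, a7, a8, b1, b2, b3, b4, b5, b6, b7, b8]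

theorem reaches_push {m : ℕ → ℕ} (h3 : 25 ≤ m 3) (h4 : m 4 = 1) (h22 : m 22 = 0) :
    Reaches ⟨15, m⟩ 8 fun c => c.pc = 0 ∧ c.mem 0 = m 0 ∧ c.mem 1 = m 1 ∧ c.mem 2 = m 3 ∧
      c.mem 3 = m 3 + 3 ∧ c.mem 22 = 0 ∧ c.mem (m 3) = m 2 ∧ c.mem (m 3 + 1) = m 9 ∧
      c.mem (m 3 + 2) = m 11 ∧ ∀ i, 25 ≤ i → i < m 3 → c.mem i = m i := by
  refine reaches_store rfl fun m1 a1 b1 => ?_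
  refine reaches_add rfl fun m2 a2 b2 => ?_
  refine reaches_add rfl fun m3 a3 b3 => ?_
  have e3 : m3 3 = m 3 + 1 := by simp (disch := omega) only [a3, b2, b1, h4]
  refine reaches_store rfl fun m4 a4 b4 => ?_
  refine reaches_add rfl fun m5 a5 b5 => ?_
  have e5 : m5 3 = m 3 + 2 := by simp (disch := omega) only [a5, b4, b3, b2, b1, h4, e3]
  refine reaches_store rfl fun m6 a6 b6 => ?_
  refine reaches_add rfl fun m7 a7 b7 => ?_
  rw [e3] at a4; rw [e5] at a6
  have e7 : m7 22 = 0 := by simp (disch := omega) only [b7, b6, b5, b4, b3, b2, b1, h22]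
  refine reaches_jump rfl e7 (.refl (N := 0) ⟨rfl, ?_, ?_, ?_, ?_, ?_, ?_, ?_, ?_, ?_⟩)
  rotate_right
  · intro i hi hi'
    simp (disch := omega) only [b1, b2, b3, b4, b5, b6, b7]
  all_goals
    simp (disch := omega) only
      [a1, a2, a3, a4, a5, a6, a7, b1, b2, b3, b4, b5, b6, b7, h4, h22, add_zero]

theorem reaches_move {m : ℕ → ℕ} (h0 : 25 ≤ m 0) (h03 : m 0 < m 3) (h4 : m 4 = 1)
    (h22 : m 22 = 0) :
    Reaches ⟨12, m⟩ (3 + 8) fun c => c.pc = 0 ∧ c.mem 0 = m 5 ∧ c.mem 1 = m 0 ∧ c.mem 2 = m 3 ∧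
      c.mem 3 = m 3 + 3 ∧ c.mem 22 = 0 ∧ c.mem (m 3) = m 2 ∧ c.mem (m 3 + 1) = m 9 ∧
      c.mem (m 3 + 2) = m 11 ∧ c.mem (m 0) = m 1 ∧
      ∀ i, 25 ≤ i → i < m 3 → i ≠ m 0 → c.mem i = m i := by
  refine reaches_store rfl fun m1 a1 b1 => ?_
  refine reaches_add rfl fun m2 a2 b2 => ?_
  refine reaches_add rfl fun m3 a3 b3 => ?_
  have e : ∀ i, i < 25 → i ≠ 0 → i ≠ 1 → m3 i = m i := fun i h h' h'' => by
    rw [b3 _ h', b2 _ h'', b1 _ (by omega)]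
  have e0 : m3 0 = m 5 := by simp (disch := omega) only [a3, b2, b1, h22, add_zero]
  have e1 : m3 1 = m 0 := by simp (disch := omega) only [a2, b3, b1, h22, add_zero]
  refine (reaches_push (m := m3) ?_ ?_ ?_).trans (N' := 0) fun c hc => .refl ?_
  · rw [e 3] <;> omega
  · rw [e 4] <;> omega
  · rw [e 22] <;> omega
  · obtain ⟨hp, q0, q1, q2, q3, q22, q4, q5, q6, q7⟩ := hc
    rw [e 3 (by omega) (by omega) (by omega)] at q2 q3 q4 q5 q6 q7
    rw [e 2 (by omega) (by omega) (by omega)] at q4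
    rw [e 9 (by omega) (by omega) (by omega)] at q5
    rw [e 11 (by omega) (by omega) (by omega)] at q6
    refine ⟨hp, by rw [q0, e0], by rw [q1, e1], q2, q3, q22, q4, q5, q6, ?_, ?_⟩
    · rw [q7 _ h0 h03]
      simp (disch := omega) only [a1, b2, b3]
    · intro i hi hi' hi''
      rw [q7 _ hi hi']
      simp (disch := omega) only [b1, b2, b3]

/-! ### The effect of the transitions on memory -/

/-- The effect of a transition that moves the rightmost active node `m 0`, after the bite of the
node `n` has been written to it, and that pushes the history entry `x`, `y`. -/
structure MoveEffect (m m' : ℕ → ℕ) (n x y : ℕ) : Prop where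
  act : m' 0 = m (m 0)
  ev : m' 1 = m 0
  hist : m' 2 = m 3
  free : m' 3 = m 3 + 3
  zero : m' 22 = 0
  hist_link : m' (m 3) = m 2
  hist_fst : m' (m 3 + 1) = x
  hist_snd : m' (m 3 + 2) = y
  link : m' (m 0) = m 1
  bite : ∀ i, 1 ≤ i → i ≤ 3 → m' (m 0 + i) = m (n + i)
  rest : ∀ i, 25 ≤ i → i < m 3 → (i < m 0 ∨ m 0 + 4 ≤ i) → m' i = m i

/-- The search transition. -/
theorem reaches_search {m : ℕ → ℕ} (h0 : 25 ≤ m 0) (h03 : m 0 + 4 ≤ m 3) (h22 : m 22 = 0)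
    (htag : m (m 0 + 1) ≠ 0) :
    Reaches ⟨1, m⟩ 22 fun c => c.pc = 0 ∧ MoveEffect m c.mem (m 0) 0 0 := by
  refine reaches_decode (N := 14) h0 fun m1 d4 d5 d6 d7 d8 d9 d10 d11 d => ?_
  refine reaches_pass rfl (by rwa [d7]) ?_
  refine reaches_const rfl fun m2 a2 b2 => ?_
  refine reaches_const rfl fun m3 a3 b3 => ?_
  have e : ∀ i, (i < 4 ∨ 22 ≤ i) → m3 i = m i := fun i hi => by
    simp (disch := omega) only [b3, b2, d]
  refine (reaches_move (m := m3) ?_ ?_ ?_ ?_).trans (N' := 0) fun c hc => .refl ?_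
  · rw [e] <;> omega
  · rw [e, e] <;> omega
  · simp (disch := omega) only [b3, b2, d4]
  · rw [e] <;> omega
  · simp only [b3 5 (by omega), b2 5 (by omega), d5, e 3 (by omega), e 2 (by omega),
      e 1 (by omega), e 0 (by omega), a3, b3 9 (by omega), a2] at hc
    obtain ⟨hp, q0, q1, q2, q3, q22, q4, q5, q6, q7, q8⟩ := hc
    refine ⟨hp, ⟨q0, q1, q2, q3, q22, q4, q5, q6, q7, ?_, ?_⟩⟩
    · intro i hi hi'
      rw [q8 _ (by omega) (by omega) (by omega), e _ (by omega)]
    · intro i hi hi' hi''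
      rw [q8 _ (by omega) (by omega) (by omega), e _ (by omega)]

/-- The node is an application, and the bite of its function is decoded as well. -/
theorem reaches_function {Q : Config → Prop} {N : ℕ} {m : ℕ → ℕ}
    (h0 : 25 ≤ m 0) (htag : m (m 0 + 1) = 0) (hx : 25 ≤ m (m 0 + 2))
    (h : ∀ m' : ℕ → ℕ, m' 4 = 1 → m' 5 = m (m 0) → m' 6 = m 0 + 1 →
      m' 8 = m 0 + 2 → m' 9 = m (m 0 + 2) → m' 10 = m 0 + 3 →
      m' 11 = m (m 0 + 3) → m' 13 = m (m (m 0 + 2) + 1) - 1 → m' 14 = m (m (m 0 + 2) + 2) →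
      m' 15 = m (m (m 0 + 2) + 3) → (∀ i, (i < 4 ∨ 22 ≤ i) → m' i = m i) →
      Reaches ⟨30, m'⟩ N Q) :
    Reaches ⟨1, m⟩ (N + 8 + 8) Q := by
  refine reaches_decode h0 fun m1 d4 d5 d6 d7 d8 d9 d10 d11 d => ?_
  refine reaches_jump rfl (by rwa [d7]) ?_
  refine reaches_add rfl fun m2 a2 b2 => ?_
  have e2 : m2 12 = m (m 0 + 2) + 1 := by simp (disch := omega) only [a2, d4, d9]
  refine reaches_load rfl fun m3 a3 b3 => ?_
  refine reaches_add rfl fun m4 a4 b4 => ?_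
  have e4 : m4 12 = m (m 0 + 2) + 2 := by
    simp (disch := omega) only [a4, b3, e2, b2, d4]
  refine reaches_load rfl fun m5 a5 b5 => ?_
  refine reaches_add rfl fun m6 a6 b6 => ?_
  have e6 : m6 12 = m (m 0 + 2) + 3 := by
    simp (disch := omega) only [a6, b5, b4, b3, e4, b2, d4]
  refine reaches_load rfl fun m7 a7 b7 => ?_
  refine reaches_sub rfl fun m8 a8 b8 => ?_
  rw [e2] at a3; rw [e4] at a5; rw [e6] at a7
  refine h m8 ?_ ?_ ?_ ?_ ?_ ?_ ?_ ?_ ?_ ?_ fun i hi => ?_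
  all_goals
    simp (disch := omega) only [a8, b8, a7, b7, b6, a5, b5, b4, a3, b3, b2,
      d4, d5, d6, d8, d9, d10, d11, d]

/-- The transition `m2`: the returned node `n` is the argument if the function is an identity, which
shows in the equality of the last two cells of its node. -/
theorem reaches_return {m : ℕ → ℕ} (h0 : 25 ≤ m 0) (h03 : m 0 + 4 ≤ m 3) (h22 : m 22 = 0)
    (htag : m (m 0 + 1) = 0) (hx : 25 ≤ m (m 0 + 2)) (hxtag : m (m (m 0 + 2) + 1) = 1) {n : ℕ}
    (hn : n = if m (m (m 0 + 2) + 3) = m (m (m 0 + 2) + 2) then m (m 0 + 3)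
      else m (m (m 0 + 2) + 3))
    (hn25 : 25 ≤ n) (hna : n + 4 ≤ m 0 ∨ m 0 + 4 ≤ n) :
    Reaches ⟨1, m⟩ 50 fun c =>
      c.pc = 0 ∧ MoveEffect m c.mem n (m (m 0 + 2)) (m (m 0 + 3)) := by
  refine reaches_function (N := 34) h0 htag hx
    fun m1 d4 d5 d6 d8 d9 d10 d11 d13 d14 d15 d => ?_
  refine reaches_jump rfl (by rw [d13, hxtag]) ?_
  refine reaches_sub rfl fun m2 a2 b2 => ?_
  refine reaches_sub rfl fun m3 a3 b3 => ?_
  refine reaches_add rfl fun m4 a4 b4 => ?_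
  have e20 : m4 20 = (m1 15 - m1 14) + (m1 14 - m1 15) := by
    simp (disch := omega) only [a4, b3, a3, a2, b2]
  have e : ∀ i, i ≠ 12 → i ≠ 20 → m4 i = m1 i := fun i hi hi' => by
    simp (disch := omega) only [b4, b3, b2]
  have hcont : ∀ m5 : ℕ → ℕ, m5 12 = n → (∀ i, i ≠ 12 → i ≠ 20 → m5 i = m1 i) →
      Reaches ⟨80, m5⟩ 22 fun c =>
        c.pc = 0 ∧ MoveEffect m c.mem n (m (m 0 + 2)) (m (m 0 + 3)) := by
    intro m5 f12 f
    refine reaches_add rfl fun m6 a6 b6 => ?_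
    have e6 : m6 12 = n + 1 := by simp (disch := omega) only [a6, f12, f, d4]
    refine reaches_load rfl fun m7 a7 b7 => ?_
    have e7 : m7 6 = m 0 + 1 := by simp (disch := omega) only [b7, b6, f, d6]
    refine reaches_store rfl fun m8 a8 b8 => ?_
    refine reaches_add rfl fun m9 a9 b9 => ?_
    have e9 : m9 12 = n + 2 := by
      simp (disch := omega) only [a9, b8, b7, e6, b6, f, d4]
    refine reaches_load rfl fun m10 a10 b10 => ?_
    have e10 : m10 8 = m 0 + 2 := by
      simp (disch := omega) only [b10, b9, b8, b7, b6, f, d8]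
    refine reaches_store rfl fun m11 a11 b11 => ?_
    refine reaches_add rfl fun m12 a12 b12 => ?_
    have e12 : m12 12 = n + 3 := by
      simp (disch := omega) only [a12, b11, b10, b9, b8, b7, e9, b6, f, d4]
    refine reaches_load rfl fun m13 a13 b13 => ?_
    have e13 : m13 10 = m 0 + 3 := by
      simp (disch := omega) only [b13, b12, b11, b10, b9, b8, b7, b6, f, d10]
    refine reaches_store rfl fun m14 a14 b14 => ?_
    have e14 : m14 22 = 0 := by
      simp (disch := omega) only [b14, b13, b12, b11, b10, b9, b8, b7, b6, f, d, h22]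
    rw [e6] at a7; rw [e7] at a8; rw [e9] at a10; rw [e10] at a11; rw [e12] at a13
    rw [e13] at a14
    refine reaches_jump rfl e14 ?_
    have g : ∀ i, i < 25 → i ≠ 12 → i ≠ 19 → i ≠ 20 → m14 i = m1 i := fun i h1 h2 h3 h4 => by
      simp (disch := omega) only [b14, b13, b12, b11, b10, b9, b8, b7, b6, f]
    have g' : ∀ i, 25 ≤ i → (i ≤ m 0 ∨ m 0 + 4 ≤ i) → m14 i = m i := fun i h1 h2 => by
      simp (disch := omega) only [b14, b13, b12, b11, b10, b9, b8, b7, b6, f, d]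
    have g1 : m14 (m 0 + 1) = m (n + 1) := by
      simp (disch := omega) only [b14, b13, b12, b11, b10, b9, a8, a7, b6, f, d]
    have g2 : m14 (m 0 + 2) = m (n + 2) := by
      simp (disch := omega) only [b14, b13, b12, a11, a10, b9, b8, b7, b6, f, d]
    have g3 : m14 (m 0 + 3) = m (n + 3) := by
      simp (disch := omega) only [a14, a13, b12, b11, b10, b9, b8, b7, b6, f, d]
    have g0 : ∀ i, i < 4 → m14 i = m i := fun i hi => by
      rw [g i (by omega) (by omega) (by omega) (by omega), d i (by omega)]
    refine (reaches_move (m := m14) ?_ ?_ ?_ e14).trans (N' := 1) fun c hc => .refl ?_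
    · rwa [g0 0 (by omega)]
    · rw [g0 0 (by omega), g0 3 (by omega)]; omega
    · rw [g 4 (by omega) (by omega) (by omega) (by omega), d4]
    · simp only [g 5 (by omega) (by omega) (by omega) (by omega), d5, g0 3 (by omega),
        g0 2 (by omega), g0 1 (by omega), g0 0 (by omega),
        g 9 (by omega) (by omega) (by omega) (by omega), d9,
        g 11 (by omega) (by omega) (by omega) (by omega), d11] at hc
      obtain ⟨hp, q0, q1, q2, q3, q22, q4, q5, q6, q7, q8⟩ := hc
      refine ⟨hp, ⟨q0, q1, q2, q3, q22, q4, q5, q6, q7, ?_, ?_⟩⟩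
      · intro i hi hi'
        rw [q8 _ (by omega) (by omega) (by omega)]
        interval_cases i
        · exact g1
        · exact g2
        · exact g3
      · intro i hi hi' hi''
        rw [q8 _ (by omega) (by omega) (by omega), g' _ hi (by omega)]
  split_ifs at hn with hs
  · refine reaches_jump rfl (by rw [e20, d14, d15]; omega) ?_
    refine reaches_add rfl fun m5 a5 b5 => ?_
    refine (hcont m5 ?_ fun i hi hi' => ?_).trans (N' := 6) fun c hc => .refl hc
    · simp (disch := omega) only [a5, e, d11, d, h22, hn, add_zero]
    · rw [b5 i hi, e i hi hi']
  · refine reaches_pass rfl (by rw [e20, d14, d15]; omega) ?_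
    refine reaches_add rfl fun m5 a5 b5 => ?_
    refine reaches_jump rfl (by simp (disch := omega) only [b5, e, d, h22]) ?_
    refine (hcont m5 ?_ fun i hi hi' => ?_).trans (N' := 5) fun c hc => .refl hc
    · simp (disch := omega) only [a5, e, d15, d, h22, hn, add_zero]
    · rw [b5 i hi, e i hi hi']

/-- One round of the copy loop. -/
theorem reaches_copy_one {m : ℕ → ℕ} {s e d i : ℕ} (h4 : m 4 = 1) (h22 : m 22 = 0)
    (hs : m 14 = s) (he : m 16 = e) (hd : m 17 = d) (hi : m 18 = i) (hi25 : 25 ≤ i) (hie : i < e) :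
    Reaches ⟨34, m⟩ 20 fun c => c.pc = 34 ∧ c.mem 18 = i + 1 ∧
      (∀ r < 25, r ≠ 18 → r ≠ 19 → r ≠ 20 → r ≠ 21 → c.mem r = m r) ∧
      c.mem (i + 1 + d) = relocate s e d (m 11) (m 0) (m (i + 1)) ∧
      ∀ j, 25 ≤ j → j ≠ i + 1 + d → c.mem j = m j := by
  refine reaches_sub rfl fun m1 a1 b1 => ?_
  refine reaches_pass rfl (by omega) ?_
  refine reaches_add rfl fun m2 a2 b2 => ?_
  have e2 : m2 18 = i + 1 := by simp (disch := omega) only [a2, b1, hi, h4]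
  refine reaches_load rfl fun m3 a3 b3 => ?_
  rw [e2] at a3
  have e3 : ∀ r, r ≠ 18 → r ≠ 19 → r ≠ 20 → m3 r = m r := fun r h h' h'' => by
    rw [b3 r h', b2 r h, b1 r h'']
  refine Reaches.trans (N' := 4) (reaches_relocate m3 ?_ ?_) fun c hc => ?_
  · rw [e3] <;> omega
  · rw [e3] <;> omega
  · obtain ⟨pc, m4⟩ := c
    obtain ⟨hp, a4, b4⟩ := hc
    simp only at hp a4 b4
    subst hp
    simp only [e3 14 (by omega) (by omega) (by omega), e3 16 (by omega) (by omega) (by omega),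
      e3 17 (by omega) (by omega) (by omega), e3 11 (by omega) (by omega) (by omega),
      e3 0 (by omega) (by omega) (by omega), a3, b2 (i + 1) (by omega), b1 (i + 1) (by omega),
      hs, he, hd] at a4
    have e4 : m4 18 = i + 1 := by simp (disch := omega) only [b4, b3, e2]
    refine reaches_add rfl fun m5 a5 b5 => ?_
    have e5 : m5 21 = i + 1 + d := by simp (disch := omega) only [a5, e4, b4, e3, hd]
    refine reaches_store rfl fun m6 a6 b6 => ?_
    rw [e5] at a6
    refine reaches_jump rfl ?_ (.refl (N := 1) ⟨rfl, ?_, ?_, ?_, ?_⟩)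
    · simp (disch := omega) only [b6, b5, b4, e3, h22]
    · simp (disch := omega) only [b6, b5, e4]
    · intro r h h1 h2 h3 h4
      simp (disch := omega) only [b6, b5, b4, e3]
    · simp (disch := omega) only [a6, b5, a4]
    · intro j hj hj'
      simp (disch := omega) only [b6, b5, b4, e3]

/-- The copy loop.  The copy lies beyond the block, so that it overwrites nothing that is still to
be read. -/
theorem reaches_copy {s e d : ℕ} (hs25 : 25 ≤ s) (hed : e < s + d) : ∀ (k : ℕ) {m : ℕ → ℕ} {i : ℕ},
    m 4 = 1 → m 22 = 0 → m 14 = s → m 16 = e → m 17 = d → m 18 = i → s ≤ i → i + k = e →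
    Reaches ⟨34, m⟩ (20 * k + 2) fun c => c.pc = 56 ∧
      (∀ r < 25, r ≠ 18 → r ≠ 19 → r ≠ 20 → r ≠ 21 → c.mem r = m r) ∧
      (∀ j, i < j → j ≤ e → c.mem (j + d) = relocate s e d (m 11) (m 0) (m j)) ∧
      ∀ j, 25 ≤ j → (j ≤ i + d ∨ e + d < j) → c.mem j = m j
  | 0, m, i, h4, h22, hs, he, hd, hi, hsi, hk => by
      refine reaches_sub rfl fun m1 a1 b1 => ?_
      refine reaches_jump rfl (by omega) (.refl ⟨rfl, fun r _ _ _ h _ => b1 r h, ?_, ?_⟩)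
      · intro j _ _; omega
      · intro j _ _; exact b1 j (by omega)
  | k + 1, m, i, h4, h22, hs, he, hd, hi, hsi, hk => by
      rw [show 20 * (k + 1) + 2 = 20 + (20 * k + 2) by omega]
      refine (reaches_copy_one h4 h22 hs he hd hi (by omega) (by omega)).trans fun c hc => ?_
      obtain ⟨pc, m1⟩ := c
      obtain ⟨hp, a18, ar, ai, aj⟩ := hc
      simp only at hp a18 ar ai aj
      subst hp
      have e1 : ∀ r, r < 18 ∨ r = 22 → m1 r = m r := fun r hr =>
        ar r (by omega) (by omega) (by omega) (by omega) (by omega)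
      refine (reaches_copy hs25 hed k (m := m1) (i := i + 1) ?_ ?_ ?_ ?_ ?_ a18 (by omega)
        (by omega)).trans (N' := 0) fun c hc => .refl ?_
      · rw [e1 _ (by omega), h4]
      · rw [e1 _ (by omega), h22]
      · rw [e1 _ (by omega), hs]
      · rw [e1 _ (by omega), he]
      · rw [e1 _ (by omega), hd]
      · obtain ⟨hp, br, bc, bj⟩ := hc
        refine ⟨hp, fun r h h1 h2 h3 h4 => ?_, fun j hj hj' => ?_, fun j hj hj' => ?_⟩
        · rw [br r h h1 h2 h3 h4, ar r h h1 h2 h3 h4]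
        · rcases Nat.lt_or_ge (i + 1) j with h | h
          · rw [bc j h hj', e1 11 (by omega), e1 0 (by omega), aj j (by omega) (by omega)]
          · obtain rfl : j = i + 1 := by omega
            rw [bj _ (by omega) (by omega), ai]
        · rw [bj j hj (by omega), aj j hj (by omega)]

/-- The three cells that describe the bite of the leftmost copied node are moved to the node
`a`. -/
theorem reaches_copy_bite {m : ℕ → ℕ} {a : ℕ} (ha : 25 ≤ a) (haf : a + 4 ≤ m 3) (h4 : m 4 = 1)
    (h6 : m 6 = a + 1) (h8 : m 8 = a + 2) (h10 : m 10 = a + 3) :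
    Reaches ⟨56, m⟩ 10 fun c => c.pc = 66 ∧ (∀ r < 25, r ≠ 19 → r ≠ 21 → c.mem r = m r) ∧
      (∀ i, 1 ≤ i → i ≤ 3 → c.mem (a + i) = m (m 3 + 1 + i)) ∧
      ∀ r, 25 ≤ r → (r ≤ a ∨ a + 4 ≤ r) → c.mem r = m r := by
  refine reaches_add rfl fun m6 a6 b6 => ?_
  have e6 : m6 21 = m 3 + 1 := by rw [a6, h4]
  refine reaches_add rfl fun m7 a7 b7 => ?_
  have e7 : m7 21 = m 3 + 1 + 1 := by rw [a7, e6, b6 4 (by omega), h4]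
  refine reaches_load rfl fun m8 a8 b8 => ?_
  have e8 : m8 6 = a + 1 := by simp (disch := omega) only [b8, b7, b6, h6]
  refine reaches_store rfl fun m9 a9 b9 => ?_
  refine reaches_add rfl fun m10 a10 b10 => ?_
  have e10 : m10 21 = m 3 + 1 + 2 := by
    simp (disch := omega) only [a10, b9, b8, e7, b7, b6, h4]
  refine reaches_load rfl fun m11 a11 b11 => ?_
  have e11 : m11 8 = a + 2 := by simp (disch := omega) only [b11, b10, b9, b8, b7, b6, h8]
  refine reaches_store rfl fun m12 a12 b12 => ?_
  refine reaches_add rfl fun m13 a13 b13 => ?_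
  have e13 : m13 21 = m 3 + 1 + 3 := by
    simp (disch := omega) only [a13, b12, b11, e10, b10, b9, b8, b7, b6, h4]
  refine reaches_load rfl fun m14 a14 b14 => ?_
  have e14 : m14 10 = a + 3 := by
    simp (disch := omega) only [b14, b13, b12, b11, b10, b9, b8, b7, b6, h10]
  refine reaches_store rfl fun m15 a15 b15 => ?_
  rw [e7] at a8; rw [e8] at a9; rw [e10] at a11; rw [e11] at a12; rw [e13] at a14
  rw [e14] at a15
  refine .refl (N := 0) ⟨rfl, fun r h h' h'' => ?_, fun i hi hi' => ?_, fun r h h' => ?_⟩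
  · simp (disch := omega) only [b15, b14, b13, b12, b11, b10, b9, b8, b7, b6]
  · interval_cases i
    · simp (disch := omega) only [b15, b14, b13, b12, b11, b10, a9, a8, b7, b6]
    · simp (disch := omega) only [b15, b14, b13, a12, a11, b10, b9, b8, b7, b6]
    · simp (disch := omega) only [a15, a14, b13, b12, b11, b10, b9, b8, b7, b6]
  · simp (disch := omega) only [b15, b14, b13, b12, b11, b10, b9, b8, b7, b6]

/-- The effect of a transition that enters the body of the abstraction at the node `x`, whose
block is `s, …, e`, with the argument `y`. -/
structure EnterEffect (m m' : ℕ → ℕ) (s e x y : ℕ) : Prop where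
  act : m' 0 = relocate s e (m 3 - s) y (m 0) (m (x + 3))
  ev : m' 1 = m 1
  hist : m' 2 = e + (m 3 - s) + 1
  free : m' 3 = e + (m 3 - s) + 4
  zero : m' 22 = 0
  hist_link : m' (e + (m 3 - s) + 1) = m 2
  hist_fst : m' (e + (m 3 - s) + 2) = x
  hist_snd : m' (e + (m 3 - s) + 3) = y
  bite : ∀ i, 1 ≤ i → i ≤ 3 → m' (m 0 + i) = relocate s e (m 3 - s) y (m 0) (m (s + 1 + i))
  copy : ∀ i, s < i → i ≤ e →
    m' (i + (m 3 - s)) = relocate s e (m 3 - s) y (m 0) (m i)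
  rest : ∀ i, 25 ≤ i → i < m 3 → (i ≤ m 0 ∨ m 0 + 4 ≤ i) → m' i = m i

/-- The transition `m1`. -/
theorem reaches_enter {m : ℕ → ℕ} {s e : ℕ} (h0 : 25 ≤ m 0) (h03 : m 0 + 4 ≤ m 3)
    (h22 : m 22 = 0) (htag : m (m 0 + 1) = 0) (hx : 25 ≤ m (m 0 + 2))
    (hxtag : m (m (m 0 + 2) + 1) = 2) (hs : m (m (m 0 + 2) + 2) = s) (he : m s = e)
    (hs25 : 25 ≤ s) (hse : s + 4 ≤ e) (he3 : e < m 3)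
    (hbs : s < m (m (m 0 + 2) + 3)) (hbe : m (m (m 0 + 2) + 3) ≤ e) :
    Reaches ⟨1, m⟩ (20 * (e - s) + 70) fun c =>
      c.pc = 0 ∧ EnterEffect m c.mem s e (m (m 0 + 2)) (m (m 0 + 3)) := by
  refine reaches_function (N := 20 * (e - s) + 54) h0 htag hx
    fun m1 d4 d5 d6 d8 d9 d10 d11 d13 d14 d15 d => ?_
  rw [hs] at d14
  rw [hxtag] at d13
  refine reaches_pass rfl (by rw [d13]; omega) ?_
  refine reaches_load rfl fun m2 a2 b2 => ?_
  rw [d14, d s (by omega), he] at a2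
  refine reaches_sub rfl fun m3 a3 b3 => ?_
  have e3 : m3 17 = m 3 - s := by simp (disch := omega) only [a3, b2, d, d14]
  refine reaches_add rfl fun m4 a4 b4 => ?_
  have e4 : m4 18 = s := by simp (disch := omega) only [a4, b3, b2, d14, d, h22, add_zero]
  have r4 : ∀ r, r ≠ 16 → r ≠ 17 → r ≠ 18 → m4 r = m1 r := fun r h h' h'' => by
    rw [b4 r h'', b3 r h', b2 r h]
  set D := m 3 - s with hD
  have hcopy := reaches_copy (s := s) (e := e) (d := D) hs25 (by omega) (e - s) (m := m4) (i := s)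
    (by simp (disch := omega) only [r4, d4]) (by simp (disch := omega) only [r4, d, h22])
    (by simp (disch := omega) only [r4, d14])
    (by simp (disch := omega) only [b4, b3, a2]) (by simp (disch := omega) only [b4, e3])
    e4 le_rfl (by omega)
  refine (hcopy.trans (N' := 48) fun c hc => ?_)
  obtain ⟨pc, m5⟩ := c
  obtain ⟨hp, f, fc, fj⟩ := hc
  simp only at hp f fc fj
  subst hp
  have g5 : ∀ r, r < 4 ∨ r = 22 → m5 r = m r := fun r hr => by
    rw [f r (by omega) (by omega) (by omega) (by omega) (by omega),
      r4 r (by omega) (by omega) (by omega), d r (by omega)]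
  have c5 : ∀ r, r < 16 → m5 r = m1 r := fun r hr => by
    rw [f r (by omega) (by omega) (by omega) (by omega) (by omega),
      r4 r (by omega) (by omega) (by omega)]
  have c16 : m5 16 = e := by simp (disch := omega) only [f, b4, b3, a2]
  have c17 : m5 17 = D := by simp (disch := omega) only [f, b4, e3]
  have g5' : ∀ r, 25 ≤ r → r < m 3 → m5 r = m r := fun r hr hr' => by
    rw [fj r hr (by omega), r4 r (by omega) (by omega) (by omega), d r (by omega)]
  have fc' : ∀ j, s < j → j ≤ e → m5 (j + D) = relocate s e D (m (m 0 + 3)) (m 0) (m j) := by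
    intro j hj hj'
    rw [fc j hj hj', r4 11 (by omega) (by omega) (by omega), d11,
      r4 0 (by omega) (by omega) (by omega), d 0 (by omega),
      r4 j (by omega) (by omega) (by omega), d j (by omega)]
  have i4 : m5 4 = 1 := by rw [c5 4 (by omega), d4]
  have hfree : m 3 = s + D := by omega
  refine (reaches_copy_bite (a := m 0) (m := m5) h0 (by rw [g5 3 (by omega)]; exact h03) i4
    (by rw [c5 6 (by omega), d6]) (by rw [c5 8 (by omega), d8])
    (by rw [c5 10 (by omega), d10])).trans (N' := 38) fun c hc => ?_
  obtain ⟨pc, m15⟩ := c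
  obtain ⟨hp, w15, p15, r15⟩ := hc
  simp only [g5 3 (Or.inl (by omega))] at hp w15 p15 r15
  subst hp
  refine reaches_sub rfl fun m16 a16 b16 => ?_
  refine reaches_sub rfl fun m17 a17 b17 => ?_
  have e17 : m17 20 = m (m (m 0 + 2) + 3) - s - 1 := by
    simp (disch := omega) only [a17, a16, b16, w15, c5, d15, d14, d4]
  have w17 : ∀ r, r < 25 → r ≠ 19 → r ≠ 20 → r ≠ 21 → m17 r = m5 r := fun r h h' h'' h3 => by
    rw [b17 r h'', b16 r h'', w15 r h h' h3]
  have hcont : ∀ m18 : ℕ → ℕ,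
      m18 0 = relocate s e D (m (m 0 + 3)) (m 0) (m (m (m 0 + 2) + 3)) →
      (∀ r, r ≠ 0 → m18 r = m17 r) →
      Reaches ⟨70, m18⟩ 11 fun c =>
        c.pc = 0 ∧ EnterEffect m c.mem s e (m (m 0 + 2)) (m (m 0 + 3)) := by
    intro m18 a18 b18
    refine reaches_add rfl fun m19 a19 b19 => ?_
    have e19 : m19 3 = e + D := by simp (disch := omega) only [a19, b18, w17, c16, c17]
    refine reaches_add rfl fun m20 a20 b20 => ?_
    have e20 : m20 3 = e + D + 1 := by
      simp (disch := omega) only [a20, e19, b19, b18, w17, i4]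
    have h20 : m20 22 = 0 := by
      simp (disch := omega) only [b20, b19, b18, w17, g5, h22]
    refine reaches_jump rfl h20 ?_
    refine (reaches_push (m := m20) (by omega) ?_ h20).trans (N' := 0) fun c hc => .refl ?_
    · simp (disch := omega) only [b20, b19, b18, w17, i4]
    · have e0 : m20 0 = m18 0 := by rw [b20 0 (by omega), b19 0 (by omega)]
      have w20 : ∀ r, r < 25 → r ≠ 0 → r ≠ 3 → r ≠ 19 → r ≠ 20 → r ≠ 21 → m20 r = m5 r :=
        fun r h h0 h3 h' h'' h4 => by
          rw [b20 r h3, b19 r h3, b18 r h0, w17 r h h' h'' h4]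
      have r20 : ∀ r, 25 ≤ r → m20 r = m15 r := fun r h => by
        rw [b20 r (by omega), b19 r (by omega), b18 r (by omega), b17 r (by omega),
          b16 r (by omega)]
      rw [e0, a18, w20 1 (by omega) (by omega) (by omega) (by omega) (by omega) (by omega),
        g5 1 (by omega), e20,
        w20 2 (by omega) (by omega) (by omega) (by omega) (by omega) (by omega),
        g5 2 (by omega), w20 9 (by omega) (by omega) (by omega) (by omega) (by omega) (by omega),
        c5 9 (by omega), d9,
        w20 11 (by omega) (by omega) (by omega) (by omega) (by omega) (by omega),
        c5 11 (by omega), d11] at hc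
      obtain ⟨hp, q0, q1, q2, q3, q22, q4, q5, q6, q7⟩ := hc
      refine ⟨hp, ⟨q0, q1, q2, q3, q22, q4, q5, q6, ?_, ?_, ?_⟩⟩
      · intro i hi hi'
        rw [q7 _ (by omega) (by omega), r20 _ (by omega), ← hD, ← fc' _ (by omega) (by omega),
          p15 i hi hi']
        congr 1
        omega
      · intro i hi hi'
        rw [← hD, q7 _ (by omega) (by omega), r20 _ (by omega), r15 _ (by omega) (by omega),
          fc' i hi hi']
      · intro i hi hi' hi''
        rw [q7 _ (by omega) (by omega), r20 _ (by omega), r15 _ (by omega) (by omega),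
          g5' i hi hi']
  by_cases hb : m (m (m 0 + 2) + 3) = s + 1
  · refine reaches_jump rfl (by rw [e17]; omega) ?_
    -- the body has a single entry, and its node is that of the application
    refine (hcont m17 ?_ fun _ _ => rfl).trans (N' := 24) fun c hc => .refl hc
    rw [w17 0 (by omega) (by omega) (by omega) (by omega), g5 0 (by omega), hb, relocate,
      if_neg (by omega), if_neg (by omega), if_neg (by omega), if_pos rfl]
  · refine reaches_pass rfl (by rw [e17]; omega) ?_
    refine reaches_add rfl fun m18 a18 b18 => ?_
    refine (hcont m18 ?_ b18).trans (N' := 23) fun c hc => .refl hc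
    rw [a18, w17 15 (by omega) (by omega) (by omega) (by omega), c5 15 (by omega), d15,
      w17 17 (by omega) (by omega) (by omega) (by omega), c17, relocate,
      if_neg (by omega), if_neg (by omega), if_neg (by omega), if_neg hb]

/-! ### The syntactic invariant -/

/-- The invariant of the environment `act ++ ev` of a reachable state.  The bound `N` on the
blocks makes copying a body cheap; the other conditions make copying correct. -/
structure Good (N : ℕ) (E : Env) : Prop where
  nodup : (Env.domList E).Nodup
  dom_bn : ∀ w ∈ Env.dom E, w ∉ Env.bn E
  closed : Env.occ E ⊆ Env.dom E
  wf : Env.WF E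
  size : ∀ e ∈ E, Bite.blockLength e.2 ≤ N

theorem Env.dom_eq_of_domList_eq {E F : Env} (h : Env.domList E = Env.domList F) :
    Env.dom E = Env.dom F := by
  ext w; rw [← Env.mem_domList, h, Env.mem_domList]

theorem Env.names_of_mem {E : Env} {z : Option ℕ} {b : Bite} (h : (z, b) ∈ E) :
    Bite.names b ⊆ Env.names E := fun _ hw => Env.mem_names.2 (Or.inr ⟨_, h, hw⟩)

/-- The transition `m2` duplicates a bite of the evaluated environment. -/
theorem Good.replace {N : ℕ} {E₁ E₂ : Env} {z z' : Option ℕ} {b v : Bite}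
    (h : Good N (E₁ ++ (z, b) :: E₂)) (hv : (z', v) ∈ E₂) : Good N (E₁ ++ (z, v) :: E₂) := by
  have hl : Env.domList (E₁ ++ (z, v) :: E₂) = Env.domList (E₁ ++ (z, b) :: E₂) := by
    simp [Env.domList_append, Env.domList_cons]
  have hd := Env.dom_eq_of_domList_eq hl
  have hmem : ∀ e ∈ E₁ ++ (z, v) :: E₂, ∃ e' ∈ E₁ ++ (z, b) :: E₂, e.2 = e'.2 := by
    intro e he
    simp only [List.mem_append, List.mem_cons] at he
    rcases he with he | rfl | he
    · exact ⟨e, by simp [he], rfl⟩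
    · exact ⟨(z', v), by simp [hv], rfl⟩
    · exact ⟨e, by simp [he], rfl⟩
  refine ⟨by rw [hl]; exact h.nodup, fun w hw hb => ?_, fun w hw => ?_, ?_, fun e he => ?_⟩
  · obtain ⟨e, he, hb⟩ := Env.mem_bn.1 hb
    obtain ⟨e', he', h2⟩ := hmem e he
    exact h.dom_bn w (hd ▸ hw) (Env.mem_bn.2 ⟨e', he', h2 ▸ hb⟩)
  · obtain ⟨e, he, ho⟩ := Env.mem_occ.1 hw
    obtain ⟨e', he', h2⟩ := hmem e he
    rw [hd]
    exact h.closed (Env.mem_occ.2 ⟨e', he', h2 ▸ ho⟩)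
  · refine Env.wf_iff.2 fun e he => ?_
    obtain ⟨e', he', h2⟩ := hmem e he
    exact h2 ▸ Env.wf_iff.1 h.wf e' he'
  · obtain ⟨e', he', h2⟩ := hmem e he
    exact h2 ▸ h.size e' he'

/-! Changing only the variables of the entries changes none of the following. -/

theorem bn_map_names (g : Option ℕ → Option ℕ) (E : Env) :
    Env.bn (E.map fun e => (g e.1, e.2)) = Env.bn E := by
  ext w; simp only [Env.mem_bn, List.mem_map, exists_exists_and_eq_and]

theorem occ_map_names (g : Option ℕ → Option ℕ) (E : Env) :
    Env.occ (E.map fun e => (g e.1, e.2)) = Env.occ E := by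
  ext w; simp only [Env.mem_occ, List.mem_map, exists_exists_and_eq_and]

theorem wf_map_names (g : Option ℕ → Option ℕ) (E : Env) :
    Env.WF (E.map fun e => (g e.1, e.2)) ↔ Env.WF E := by
  simp only [Env.wf_iff, List.forall_mem_map]

theorem cellLength_map_names (g : Option ℕ → Option ℕ) : ∀ E : Env,
    Env.cellLength (E.map fun e => (g e.1, e.2)) = Env.cellLength E
  | [] => rfl
  | (z, b) :: E => by
      have := cellLength_map_names g E
      simp [Env.cellLength, this]

theorem nodes_map_names (g : Option ℕ → Option ℕ) : ∀ (a : ℕ) (E : Env),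
    Env.nodes a (E.map fun e => (g e.1, e.2)) = Env.nodes a E
  | _, [] => rfl
  | a, (z, b) :: E => by
      have := nodes_map_names g (a + 4 + Bite.blockLength b) E
      simp [Env.nodes, this]

theorem blockLength_le_cellLength {E : Env} : ∀ e ∈ E, Bite.blockLength e.2 ≤ Env.cellLength E := by
  induction E with
  | nil => simp
  | cons e E ih =>
    obtain ⟨z, b⟩ := e
    intro e he
    simp only [Env.cellLength]
    rcases List.mem_cons.1 he with rfl | he
    · simp only; omega
    · have := ih e he
      omega

/-- The transition `m1`.  The bound names of the state do not change, and the new variables are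
fresh for them. -/
theorem Good.enter {N : ℕ} {E₁ Ev E' B : Env} {z : Option ℕ} {x y x₁ : ℕ} {b' : Bite}
    {α : ℕ → ℕ} {z' : Option ℕ}
    (h : Good N (E₁ ++ (z, .app x y) :: Ev)) (hx : (z', .lam x₁ B) ∈ Ev)
    (hα : FreshRenaming α (Env.dom B) (E₁ ++ (z, .app x y) :: Ev))
    (hB : Env.subst x₁ y (Env.renameDom α B) = (none, b') :: E') :
    Good N (E₁ ++ (z, b') :: (E' ++ Ev)) := by
  set E := E₁ ++ (z, Bite.app x y) :: Ev with hE
  have hxE : (z', Bite.lam x₁ B) ∈ E := by simp [hE, hx]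
  have hnamesB : ∀ w, w ∈ Env.names B ∨ w = x₁ → w ∈ Env.names E := fun w hw =>
    Env.names_of_mem hxE (by simp only [Bite.names, Finset.mem_insert]; tauto)
  have hdl : Env.domList E' = (Env.domList B).map α := by
    have := congrArg Env.domList hB
    rw [Env.subst, Env.domList_rename, Env.domList_renameDom, Env.domList_cons] at this
    simpa using this.symm
  have hbn : Env.bn ((none, b') :: E') = Env.bn B := by
    rw [← hB, Env.subst, bn_rename.2, Env.renameDom, bn_map_names, bn_rename.2]
  have hwf : Env.WF ((none, b') :: E') ↔ Env.WF B := by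
    rw [← hB, Env.subst, wf_rename.2, Env.renameDom, wf_map_names, wf_rename.2]
  have hcl : Env.cellLength ((none, b') :: E') = Env.cellLength B := by
    rw [← hB, Env.subst, length_rename.2, Env.renameDom, cellLength_map_names, length_rename.2]
  have hd' : ∀ w, w ∈ Env.dom E' ↔ ∃ v ∈ Env.dom B, α v = w := fun w => by
    simp only [← Env.mem_domList, hdl, List.mem_map]
  have hfresh : ∀ w ∈ Env.dom E', w ∉ Env.names E := fun w hw => by
    obtain ⟨v, hv, rfl⟩ := (hd' w).1 hw
    exact hα.2.2 v hv
  have hdom : ∀ w, w ∈ Env.dom (E₁ ++ (z, b') :: (E' ++ Ev)) ↔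
      w ∈ Env.dom E ∨ w ∈ Env.dom E' := fun w => by
    simp only [hE, Env.dom_append, Env.dom_cons, Finset.mem_union]
    tauto
  have hmem : ∀ e ∈ E₁ ++ (z, b') :: (E' ++ Ev),
      e ∈ E ∨ ∃ e' ∈ (none, b') :: E', e.2 = e'.2 := by
    intro e he
    simp only [List.mem_append, List.mem_cons] at he
    rcases he with he | rfl | he | he
    · exact Or.inl (by simp [hE, he])
    · exact Or.inr ⟨(none, b'), by simp, rfl⟩
    · exact Or.inr ⟨e, by simp [he], rfl⟩
    · exact Or.inl (by simp [hE, he])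
  have hbnE : Env.bn B ⊆ Env.bn E := fun w hw =>
    Env.mem_bn.2 ⟨_, hxE, by simp [Bite.bn, hw]⟩
  refine ⟨?_, fun w hw hb => ?_, fun w hw => ?_, ?_, fun e he => ?_⟩
  · have hp : (Env.domList (E₁ ++ (z, b') :: (E' ++ Ev))).Perm
        (Env.domList E ++ Env.domList E') := by
      simp only [hE, Env.domList_append, Env.domList_cons, List.append_assoc]
      refine List.Perm.append_left _ (List.Perm.append_left _ List.perm_append_comm)
    rw [hp.nodup_iff]
    refine List.Nodup.append h.nodup ?_ fun w hw hw' => ?_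
    · rw [hdl]
      refine List.Nodup.map_on (fun v hv w hw hvw => ?_) (Env.wf_iff.1 h.wf _ hxE).1
      exact hα.2.1 (Env.mem_domList.1 hv) (Env.mem_domList.1 hw) hvw
    · exact hfresh w (Env.mem_domList.1 hw') (Env.dom_subset_names _ (Env.mem_domList.1 hw))
  · have hb' : w ∈ Env.bn E := by
      obtain ⟨e, he, hb⟩ := Env.mem_bn.1 hb
      rcases hmem e he with he | ⟨e', he', h2⟩
      · exact Env.mem_bn.2 ⟨e, he, hb⟩
      · exact hbnE (hbn ▸ Env.mem_bn.2 ⟨e', he', h2 ▸ hb⟩)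
    rcases (hdom w).1 hw with hw | hw
    · exact h.dom_bn w hw hb'
    · exact hfresh w hw (bn_subset_names.2 _ hb')
  · rw [hdom]
    obtain ⟨e, he, ho⟩ := Env.mem_occ.1 hw
    rcases hmem e he with he | ⟨e', he', h2⟩
    · exact Or.inl (h.closed (Env.mem_occ.2 ⟨e, he, ho⟩))
    · have ho' : w ∈ Env.occ (Env.subst x₁ y (Env.renameDom α B)) :=
        hB ▸ Env.mem_occ.2 ⟨e', he', h2 ▸ ho⟩
      obtain ⟨u, hu, rfl⟩ := Finset.mem_image.1 (occ_rename.2 _ _ ho')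
      rw [Env.renameDom, occ_map_names] at hu
      obtain ⟨v, hv, rfl⟩ := Finset.mem_image.1 (occ_rename.2 _ _ hu)
      by_cases hvB : v ∈ Env.dom B
      · have : α v ≠ x₁ := fun h' => hα.2.2 v hvB (hnamesB _ (Or.inr h'))
        rw [Function.update_of_ne this]
        exact Or.inr ((hd' _).2 ⟨v, hvB, rfl⟩)
      · rw [hα.1 v hvB]
        left
        by_cases hvx : v = x₁
        · subst hvx
          rw [Function.update_self]
          exact h.closed (Env.mem_occ.2 ⟨(z, .app x y), by simp [hE], by simp [Bite.occ]⟩)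
        · rw [Function.update_of_ne hvx]
          exact h.closed (Env.mem_occ.2 ⟨_, hxE, by simp [Bite.occ, hvx, hv, hvB]⟩)
  · refine Env.wf_iff.2 fun e he => ?_
    rcases hmem e he with he | ⟨e', he', h2⟩
    · exact Env.wf_iff.1 h.wf e he
    · exact h2 ▸ Env.wf_iff.1 (hwf.2 (Env.wf_iff.1 h.wf _ hxE).2) e' he'
  · rcases hmem e he with he | ⟨e', he', h2⟩
    · exact h.size e he
    · rw [h2]
      have h3 := blockLength_le_cellLength e' he'
      have h4 := h.size _ hxE
      rw [hcl] at h3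
      simp only [Bite.blockLength] at h4
      omega

/-! ### The memory invariant -/

/-- The cells that no transition changes any more: they are in use, but they do not belong to the
node of an explicit substitution of the active or evaluated environment. -/
def Frozen (free : ℕ) (ns : List ℕ) (i : ℕ) : Prop :=
  25 ≤ i ∧ i < free ∧ ∀ n ∈ ns, i < n ∨ n + 4 ≤ i

/-- The node `n` contains the bite `b`, whose block is laid out in cells that satisfy `F`.  The
block need not follow the node. -/
def Stored (m ρ : ℕ → ℕ) (F : ℕ → Prop) (b : Bite) (n : ℕ) : Prop :=
  ∃ a, ContainsAt m (n + 1) ((Bite.cells ρ a b).take 3) ∧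
    ContainsAt m (a + 4) ((Bite.cells ρ a b).drop 3) ∧
    ∀ i, a + 4 ≤ i → i < a + 4 + Bite.blockLength b → F i

/-- The cells `u`, `v` contain the history entry. -/
def HistEntry.Codes (ρ : ℕ → ℕ) (D : Finset ℕ) : HistEntry → ℕ → ℕ → Prop
  | none, u, v => u = 0 ∧ v = 0
  | some (x, y), u, v => x ∈ D ∧ y ∈ D ∧ u = ρ x ∧ v = ρ y

/-- The history stack is stored in cells that satisfy `F`, and mentions only variables in `D`. -/
def HistStored (m ρ : ℕ → ℕ) (F : ℕ → Prop) (D : Finset ℕ) : List HistEntry → ℕ → Prop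
  | [], h => h = 0
  | e :: H, h => h ≠ 0 ∧ F h ∧ F (h + 1) ∧ F (h + 2) ∧
      HistEntry.Codes ρ D e (m (h + 1)) (m (h + 2)) ∧ HistStored m ρ F D H (m h)

/-- The addresses of the variables of a state. -/
abbrev State.addr (S : State) (as bs : List ℕ) : ℕ → ℕ :=
  bind (fun _ => 0) (S.act ++ S.ev) (as ++ bs)

/-- The memory invariant; `as` and `bs` are the nodes of the active and of the evaluated
environment. -/
structure Layout (m : ℕ → ℕ) (S : State) (as bs : List ℕ) : Prop where
  length_act : S.act.length = as.length
  length_ev : S.ev.length = bs.length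
  sep : (as ++ bs).Pairwise fun p q => p + 4 ≤ q ∨ q + 4 ≤ p
  range : ∀ n ∈ as ++ bs, 25 ≤ n ∧ n + 4 ≤ m 3
  free : 25 ≤ m 3
  zero : m 22 = 0
  act : Segment m (m 0) as.reverse 0
  ev : Segment m (m 1) bs 0
  stored : ∀ p ∈ (S.act ++ S.ev).zip (as ++ bs),
    Stored m (S.addr as bs) (Frozen (m 3) (as ++ bs)) p.1.2 p.2
  hist : HistStored m (S.addr as bs) (Frozen (m 3) (as ++ bs)) (Env.dom (S.act ++ S.ev))
    S.hist (m 2)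

theorem ContainsAt.move {m m' : ℕ → ℕ} : ∀ {l : List ℕ} {a a' : ℕ}, ContainsAt m a l →
    (∀ i < l.length, m' (a' + i) = m (a + i)) → ContainsAt m' a' l
  | [], _, _, _, _ => trivial
  | v :: l, a, a', h, hm => by
      refine ⟨by simpa [h.1] using hm 0 (by simp), ContainsAt.move h.2 fun i hi => ?_⟩
      have := hm (i + 1) (by simpa using hi)
      simpa [add_assoc, add_comm 1] using this

/-- A stored bite stays stored when frozen cells, its three describing cells, and the addresses of
its names are kept; the three cells may also be copied to another node. -/
theorem Stored.transfer {m m' ρ ρ' : ℕ → ℕ} {F F' : ℕ → Prop} {b : Bite} {n n' : ℕ}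
    (h : Stored m ρ F b n) (hF : ∀ i, F i → m' i = m i ∧ F' i)
    (hn : ∀ i, 1 ≤ i → i ≤ 3 → m' (n' + i) = m (n + i))
    (hρ : ∀ w ∈ Bite.names b, ρ' w = ρ w) : Stored m' ρ' F' b n' := by
  obtain ⟨a, h1, h2, h3⟩ := h
  refine ⟨a, ?_, ?_, fun i hi hi' => (hF i (h3 i hi hi')).2⟩
  · rw [cells_congr a hρ]
    refine h1.move fun i hi => ?_
    have : i < 3 := by simp only [List.length_take] at hi; omega
    simpa [add_assoc] using hn (1 + i) (by omega) (by omega)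
  · rw [cells_congr a hρ]
    refine h2.congr fun i hi hi' => (hF i (h3 i hi ?_)).1
    simp only [List.length_drop, length_cells.1] at hi'
    omega

theorem HistEntry.Codes.transfer {ρ ρ' : ℕ → ℕ} {D D' : Finset ℕ} {e : HistEntry} {u v : ℕ}
    (h : HistEntry.Codes ρ D e u v) (hD : D ⊆ D') (hρ : ∀ w ∈ D, ρ' w = ρ w) :
    HistEntry.Codes ρ' D' e u v := by
  match e, h with
  | none, h => exact h
  | some (x, y), ⟨hx, hy, hu, hv⟩ =>
    exact ⟨hD hx, hD hy, by rw [hu, hρ x hx], by rw [hv, hρ y hy]⟩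

theorem HistStored.transfer {m m' ρ ρ' : ℕ → ℕ} {F F' : ℕ → Prop} {D D' : Finset ℕ}
    (hF : ∀ i, F i → m' i = m i ∧ F' i) (hD : D ⊆ D') (hρ : ∀ w ∈ D, ρ' w = ρ w) :
    ∀ {H : List HistEntry} {h : ℕ}, HistStored m ρ F D H h → HistStored m' ρ' F' D' H h
  | [], _, h => h
  | e :: H, h, ⟨h0, f0, f1, f2, he, hH⟩ => by
      refine ⟨h0, (hF _ f0).2, (hF _ f1).2, (hF _ f2).2, ?_, ?_⟩
      · rw [(hF _ f1).1, (hF _ f2).1]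
        exact he.transfer hD hρ
      · rw [(hF _ f0).1]
        exact HistStored.transfer hF hD hρ hH

theorem HistStored.repr {m ρ : ℕ → ℕ} {F : ℕ → Prop} {D : Finset ℕ} :
    ∀ {H : List HistEntry} {h : ℕ}, HistStored m ρ F D H h → ReprHist m ρ H h
  | [], _, h => h
  | none :: _, _, ⟨h0, _, _, _, he, hH⟩ => ⟨h0, he.1, he.2, hH.repr⟩
  | some (_, _) :: _, _, ⟨h0, _, _, _, he, hH⟩ => ⟨h0, he.2.2.1, he.2.2.2, hH.repr⟩

theorem reprEnv_of_zip {m ρ : ℕ → ℕ} : ∀ {E : Env} {as : List ℕ}, E.length = as.length →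
    (∀ p ∈ E.zip as, ReprBite m ρ p.1.2 p.2) → ReprEnv m ρ E as
  | [], [], _, _ => by simp [ReprEnv]
  | [], _ :: _, h, _ => by simp at h
  | _ :: _, [], h, _ => by simp at h
  | (z, b) :: E, a :: as, h, hp => by
      simp only [ReprEnv]
      exact ⟨a, as, rfl, hp ((z, b), a) (by simp),
        reprEnv_of_zip (by simpa using h) fun p hp' => hp p (by simp [hp'])⟩

namespace Layout

variable {m : ℕ → ℕ} {S : State} {as bs : List ℕ}

theorem length_eq (h : Layout m S as bs) : (S.act ++ S.ev).length = (as ++ bs).length := by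
  simp [h.length_act, h.length_ev]

theorem addr_mem (h : Layout m S as bs) {w : ℕ} (hw : w ∈ Env.dom (S.act ++ S.ev)) :
    S.addr as bs w ∈ as ++ bs := bind_mem hw h.length_eq

theorem addr_not_frozen (h : Layout m S as bs) (w : ℕ) :
    ¬ Frozen (m 3) (as ++ bs) (S.addr as bs w) := by
  rintro ⟨h1, h2, h3⟩
  -- an address is that of a node, or the default value `0`
  by_cases hw : w ∈ Env.dom (S.act ++ S.ev)
  · have := h3 _ (h.addr_mem hw)
    omega
  · rw [State.addr, bind_of_notMem _ hw] at h1
    omega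

theorem represents (h : Layout m S as bs) : Represents m S := by
  have hb : ∀ p ∈ (S.act ++ S.ev).zip (as ++ bs), ReprBite m (S.addr as bs) p.1.2 p.2 := by
    intro p hp
    obtain ⟨a, h1, h2, h3⟩ := h.stored p hp
    refine repr_of_cells.1 _ _ a _ h1 h2 fun w => ?_
    by_contra hc
    exact h.addr_not_frozen w (h3 _ (by omega) (by omega))
  rw [List.zip_append h.length_act] at hb
  refine ⟨as, bs, _, h.sep.imp fun h => by omega, rfl, linked_iff_segment.2 h.act,
    linked_iff_segment.2 h.ev, ?_, ?_, h.hist.repr⟩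
  · exact reprEnv_of_zip h.length_act fun p hp => hb p (by simp [hp])
  · exact reprEnv_of_zip h.length_ev fun p hp => hb p (by simp [hp])

end Layout

theorem bind_of_mem_zip {ρ : ℕ → ℕ} {z : ℕ} {b : Bite} {a : ℕ} : ∀ {E : Env} {as : List ℕ},
    (Env.domList E).Nodup → ((some z, b), a) ∈ E.zip as → bind ρ E as z = a
  | [], _, _, h => by simp at h
  | _ :: _, [], _, h => by simp at h
  | (z', b') :: E, a' :: as, hn, h => by
      simp only [List.zip_cons_cons, List.mem_cons] at h
      rcases h with h | h
      · simp only [Prod.mk.injEq] at h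
        obtain ⟨⟨rfl, rfl⟩, rfl⟩ := h
        simp [bind]
      · rw [Env.domList_cons] at hn
        have ih := bind_of_mem_zip (ρ := ρ) (List.Nodup.of_append_right hn) h
        cases z' with
        | none => simpa [bind] using ih
        | some z' =>
          have : z ≠ z' := by
            rintro rfl
            have h1 : z ∈ Env.domList E :=
              Env.mem_domList.2 (Env.mem_dom.2 ⟨b, (List.of_mem_zip h).1⟩)
            exact (List.nodup_cons.1 hn).1 h1
          simpa [bind, this] using ih

theorem exists_mem_zip_of_mem {α β : Type*} {x : α} : ∀ {l : List α} {l' : List β},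
    l.length = l'.length → x ∈ l → ∃ y, (x, y) ∈ l.zip l'
  | [], _, _, h => by simp at h
  | _ :: _, [], hl, _ => by simp at hl
  | a :: l, b :: l', hl, h => by
      rcases List.mem_cons.1 h with rfl | h
      · exact ⟨b, by simp⟩
      · obtain ⟨y, hy⟩ := exists_mem_zip_of_mem (l' := l') (by simpa using hl) h
        exact ⟨y, by simp [hy]⟩

theorem mem_of_lookup {E : Env} {z : Option ℕ} {v : Bite} (h : E.lookup z = some v) :
    (z, v) ∈ E := by
  induction E with
  | nil => simp at h
  | cons e E ih =>
    obtain ⟨z', b⟩ := e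
    rw [List.lookup_cons] at h
    split at h
    · rename_i hz
      simp only [beq_iff_eq] at hz
      simp only [Option.some.injEq] at h
      simp [hz, h]
    · simp [ih h]

/-- The node that the address of an evaluated variable points to. -/
theorem Layout.lookup {m : ℕ → ℕ} {S : State} {as bs : List ℕ} (h : Layout m S as bs)
    (hn : (Env.domList (S.act ++ S.ev)).Nodup) {x : ℕ} {v : Bite}
    (hx : S.ev.lookup (some x) = some v) :
    x ∈ Env.dom (S.act ++ S.ev) ∧ S.addr as bs x ∈ bs ∧
      Stored m (S.addr as bs) (Frozen (m 3) (as ++ bs)) v (S.addr as bs x) := by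
  have hmem := mem_of_lookup hx
  obtain ⟨n, hz⟩ := exists_mem_zip_of_mem h.length_ev hmem
  have hz' : ((some x, v), n) ∈ (S.act ++ S.ev).zip (as ++ bs) := by
    rw [List.zip_append h.length_act]; simp [hz]
  have ha : S.addr as bs x = n := bind_of_mem_zip hn hz'
  refine ⟨Env.mem_dom.2 ⟨v, by simp [hmem]⟩, ?_, ?_⟩
  · rw [ha]; exact (List.of_mem_zip hz).2
  · rw [ha]; exact h.stored _ hz'

/-! ### The transitions preserve the memory invariant -/

/-- The search transition and the transition `m2` relink the rightmost active node.  The nodes, taken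
together, and the addresses of the variables stay the same. -/
theorem Layout.move {m m' : ℕ → ℕ} {E₁ Ev : Env} {H : List HistEntry} {z : Option ℕ} {b v : Bite}
    {as bs : List ℕ} {a n x y : ℕ} {e : HistEntry}
    (h : Layout m ⟨E₁ ++ [(z, b)], Ev, H⟩ (as ++ [a]) bs)
    (hv : Stored m (State.addr ⟨E₁ ++ [(z, b)], Ev, H⟩ (as ++ [a]) bs)
      (Frozen (m 3) (as ++ [a] ++ bs)) v n)
    (he : HistEntry.Codes (State.addr ⟨E₁ ++ [(z, b)], Ev, H⟩ (as ++ [a]) bs)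
      (Env.dom (E₁ ++ [(z, b)] ++ Ev)) e x y)
    (hm : MoveEffect m m' n x y) :
    Layout m' ⟨E₁, (z, v) :: Ev, e :: H⟩ as (a :: bs) := by
  have hlist : as ++ [a] ++ bs = as ++ a :: bs := by simp
  have hseg := h.act
  simp only [List.reverse_append, List.reverse_cons, List.reverse_nil, List.nil_append,
    List.cons_append, Segment] at hseg
  obtain ⟨h0, ha0, hseg⟩ := hseg
  have hmap : (E₁ ++ (z, v) :: Ev).map Prod.fst = (E₁ ++ [(z, b)] ++ Ev).map Prod.fst := by simp
  have haddr : State.addr ⟨E₁, (z, v) :: Ev, e :: H⟩ as (a :: bs) =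
      State.addr ⟨E₁ ++ [(z, b)], Ev, H⟩ (as ++ [a]) bs := by
    simp only [State.addr]
    rw [bind_congr _ hmap, hlist]
  have hdom : Env.dom (E₁ ++ (z, v) :: Ev) = Env.dom (E₁ ++ [(z, b)] ++ Ev) := by
    simp [Env.dom_append, Env.dom_cons]
  have hrange := h.range
  have hsep := h.sep
  have hF : ∀ i, Frozen (m 3) (as ++ [a] ++ bs) i →
      m' i = m i ∧ Frozen (m' 3) (as ++ [a] ++ bs) i := by
    rintro i ⟨h1, h2, h3⟩
    have := h3 a (by simp)
    exact ⟨hm.rest i h1 h2 (by omega), h1, by rw [hm.free]; omega, h3⟩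
  have hnode : ∀ n' ∈ as ++ bs, (n' + 4 ≤ a ∨ a + 4 ≤ n') := by
    intro n' hn'
    rw [List.append_assoc, List.pairwise_append] at hsep
    simp only [List.cons_append, List.nil_append, List.pairwise_cons] at hsep
    rcases List.mem_append.1 hn' with hn' | hn'
    · exact hsep.2.2 n' hn' a (by simp)
    · exact (hsep.2.1.1 n' hn').symm
  have hkeep : ∀ n' ∈ as ++ bs, ∀ i, i ≤ 3 → m' (n' + i) = m (n' + i) := by
    intro n' hn' i hi
    have h1 := hnode n' hn'
    have h2 := hrange n' (by simp only [List.mem_append] at hn' ⊢; tauto)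
    exact hm.rest _ (by omega) (by omega) (by omega)
  constructor
  · simpa using h.length_act
  · simp [h.length_ev]
  · simpa using hsep
  · intro n' hn'
    have := hrange n' (by rwa [hlist])
    rw [hm.free]
    omega
  · rw [hm.free]
    have := h.free
    omega
  · exact hm.zero
  · rw [hm.act, h0]
    exact hseg.congr fun n' hn' => hkeep n' (by simpa using Or.inl hn') 0 (by omega)
  · refine ⟨by rw [hm.ev, h0], ha0, ?_⟩
    rw [← h0, hm.link]
    exact h.ev.congr fun n' hn' => hkeep n' (by simp [hn']) 0 (by omega)
  · rw [haddr, ← hlist]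
    have hst := h.stored
    have hl := h.length_act
    simp only [List.length_append, List.length_cons, List.length_nil, Nat.add_right_cancel_iff] at hl
    rw [List.zip_append h.length_act, List.zip_append hl] at hst
    rw [hlist, List.zip_append hl, ← hlist]
    simp only [List.zip_cons_cons, List.mem_append, List.mem_cons]
    rintro p (hp | rfl | hp)
    · exact (hst p (by simp [hp])).transfer hF
        (fun i _ hi => hkeep _ (by simp [(List.of_mem_zip hp).2]) i hi) fun _ _ => rfl
    · exact hv.transfer hF (fun i hi hi' => by rw [← hm.bite i hi hi', h0]) fun _ _ => rfl
    · exact (hst p (by simp [hp])).transfer hF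
        (fun i _ hi => hkeep _ (by simp [(List.of_mem_zip hp).2]) i hi) fun _ _ => rfl
  · rw [haddr, ← hlist]
    have hfr : ∀ i, i < 3 → Frozen (m' 3) (as ++ [a] ++ bs) (m 3 + i) := by
      intro i hi
      refine ⟨by have := h.free; omega, by rw [hm.free]; omega, fun n' hn' => ?_⟩
      have := hrange n' hn'
      omega
    have hfree := h.free
    simp only [HistStored]
    rw [hm.hist, hm.hist_fst, hm.hist_snd, hm.hist_link, hdom]
    exact ⟨by omega, hfr 0 (by omega), hfr 1 (by omega), hfr 2 (by omega), he,
      h.hist.transfer hF (Finset.Subset.refl _) fun _ _ => rfl⟩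

theorem bind_congr_base {ρ ρ' : ℕ → ℕ} {w : ℕ} (h : ρ w = ρ' w) : ∀ (E : Env) (as : List ℕ),
    bind ρ E as w = bind ρ' E as w
  | [], as => by simp [bind, h]
  | (none, b) :: E, [] => by simp [bind, h]
  | (some z, b) :: E, [] => by simp [bind, h]
  | (none, b) :: E, a :: as => by simp [bind, bind_congr_base h E as]
  | (some z, b) :: E, a :: as => by simp [bind, Function.update_apply, bind_congr_base h E as]

theorem bind_base {ρ ρ' : ℕ → ℕ} {w : ℕ} {E : Env} {as : List ℕ} (hw : w ∈ Env.dom E)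
    (h : E.length = as.length) : bind ρ' E as w = bind ρ E as w := by
  simpa using bind_map (ρ := ρ) (ρ' := ρ') (g := id) hw h

/-- Entries `F` that are inserted behind an entry do not affect the names that they do not
define. -/
theorem bind_insert_of_notMem {ρ : ℕ → ℕ} {E₁ E₂ F : Env} {z : Option ℕ} {b b' : Bite}
    {as bs ns : List ℕ} {a w : ℕ} (h : E₁.length = as.length) (hF : F.length = ns.length)
    (hw : w ∉ Env.dom F) :
    bind ρ (E₁ ++ (z, b') :: (F ++ E₂)) (as ++ a :: (ns ++ bs)) w =
      bind ρ (E₁ ++ (z, b) :: E₂) (as ++ a :: bs) w := by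
  rw [bind_append h, bind_append h]
  refine bind_congr_base ?_ _ _
  have := bind_append (ρ := ρ) (F := E₂) (bs := bs) (E := F) (as := ns) hF
  cases z <;> simp [bind, Function.update_apply, this, bind_of_notMem _ hw]

theorem bind_insert_of_mem {ρ ρ' : ℕ → ℕ} {E₁ E₂ F : Env} {z : Option ℕ} {b' : Bite}
    {as bs ns : List ℕ} {a w : ℕ} (h : E₁.length = as.length) (hF : F.length = ns.length)
    (hw : w ∈ Env.dom F) (hw' : w ∉ Env.dom (E₁ ++ [(z, b')])) :
    bind ρ (E₁ ++ (z, b') :: (F ++ E₂)) (as ++ a :: (ns ++ bs)) w = bind ρ' F ns w := by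
  have := bind_append (ρ := ρ) (E := E₁ ++ [(z, b')]) (as := as ++ [a]) (F := F ++ E₂)
    (bs := ns ++ bs) (by simp [h])
  simp only [List.append_assoc, List.cons_append, List.nil_append] at this
  rw [this, bind_of_notMem _ hw', bind_append hF]
  exact bind_base hw hF

/-- The bites of an environment that is laid out consecutively are stored. -/
theorem stored_of_cells {m ρ : ℕ → ℕ} : ∀ {E : Env} {prev a : ℕ},
    ContainsAt m a (Env.cells ρ prev a E) → ∀ p ∈ E.zip (Env.nodes a E),
      Stored m ρ (fun i => a ≤ i ∧ i < a + Env.cellLength E ∧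
        ∀ n ∈ Env.nodes a E, i < n ∨ n + 4 ≤ i) p.1.2 p.2
  | [], _, _, _, p, hp => by simp at hp
  | (z, b) :: E, prev, a, h, p, hp => by
      simp only [Env.cells, ContainsAt, containsAt_append, length_cells.1] at h
      obtain ⟨-, h1, h2⟩ := h
      rw [show a + 1 + (3 + Bite.blockLength b) = a + 4 + Bite.blockLength b by omega] at h2
      simp only [Env.nodes, List.zip_cons_cons, List.mem_cons] at hp
      simp only [Env.cellLength, Env.nodes]
      rcases hp with rfl | hp
      · rw [← List.take_append_drop 3 (Bite.cells ρ a b), containsAt_append] at h1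
        have h3 : ((Bite.cells ρ a b).take 3).length = 3 := by simp [length_cells.1]
        rw [h3] at h1
        refine ⟨a, h1.1, h1.2, fun i hi hi' => ?_⟩
        simp only at hi'
        refine ⟨by omega, by omega, fun n hn => ?_⟩
        rcases List.mem_cons.1 hn with rfl | hn
        · omega
        · have := nodes_bounds hn
          omega
      · obtain ⟨a', g1, g2, g3⟩ := stored_of_cells h2 p hp
        refine ⟨a', g1, g2, fun i hi hi' => ?_⟩
        obtain ⟨k1, k2, k3⟩ := g3 i hi hi'
        refine ⟨by omega, by omega, fun n hn => ?_⟩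
        rcases List.mem_cons.1 hn with rfl | hn
        · omega
        · exact k3 n hn

theorem nodes_rename (θ : ℕ → ℕ) (a : ℕ) (E : Env) :
    Env.nodes a (Env.rename θ E) = Env.nodes a E := by
  simpa using nodes_shift θ 0 a E

theorem nodes_renameDom (α : ℕ → ℕ) (a : ℕ) (E : Env) :
    Env.nodes a (Env.renameDom α E) = Env.nodes a E := by
  rw [Env.renameDom, nodes_map_names, nodes_rename]

theorem cellLength_renameDom (α : ℕ → ℕ) (E : Env) :
    Env.cellLength (Env.renameDom α E) = Env.cellLength E := by
  rw [Env.renameDom, cellLength_map_names, length_rename.2]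

/-- Renaming the variables that a body defines does not change its layout: the new names have the
old addresses. -/
theorem cells_renameDom {α ρ : ℕ → ℕ} {E : Env} {prev a : ℕ}
    (hα : ∀ z ∉ Env.dom E, α z = z) (hinj : Set.InjOn α (Env.dom E))
    (hfresh : ∀ z ∈ Env.dom E, α z ∉ Env.names E) :
    Env.cells (bind ρ E (Env.nodes a E)) prev a E =
      Env.cells (bind ρ (Env.renameDom α E) (Env.nodes a E)) prev a (Env.renameDom α E) := by
  have hlen : E.length = (Env.nodes a E).length := (length_nodes _ _).symm
  have hd : ∀ w ∈ Env.dom (Env.renameDom α E), ∃ z ∈ Env.dom E, α z = w := by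
    intro w hw
    rw [← Env.mem_domList, Env.domList_renameDom, List.mem_map] at hw
    simpa only [Env.mem_domList] using hw
  rw [Env.renameDom, cells_map_names, ← Env.renameDom]
  have := (cells_rename (f := id) (δ := 0) rfl rfl rfl).2 E (bind ρ E (Env.nodes a E))
    (bind ρ (Env.renameDom α E) (Env.nodes a E)) α prev a (by simp) (fun w hw => ?_)
    fun w _ => ?_
  · simpa using this
  · by_cases hwd : w ∈ Env.dom E
    · rw [Env.renameDom]
      rw [← Env.dom_rename α E] at hwd hinj
      rw [bind_map_names hwd hinj (by simpa [Env.rename_eq_map] using hlen)]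
      exact congrFun (bind_congr _ (by simp [Env.rename_eq_map])) w
    · rw [hα w hwd, id, bind_of_notMem _ hwd, bind_of_notMem]
      intro hw'
      obtain ⟨z, hz, rfl⟩ := hd w hw'
      exact hfresh z hz hw
  · by_cases hwd : w ∈ Env.dom E
    · exact Or.inr fun h => hfresh w hwd (bn_subset_names.2 _ h)
    · exact Or.inl (hα w hwd)

theorem relocate_below {s e d y a v : ℕ} (h : v < s) : relocate s e d y a v = v := by
  simp [relocate, h]

theorem relocate_above {s e d y a v : ℕ} (h : e < v) : relocate s e d y a v = v := by
  simp [relocate, h]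

theorem relocate_inside {s e d y a v : ℕ} (h : s + 1 < v) (h' : v ≤ e) :
    relocate s e d y a v = v + d := by
  rw [relocate, if_neg (by omega), if_neg (by omega), if_neg (by omega), if_neg (by omega)]

theorem relocate_param {s e d y a : ℕ} (h : s ≤ e) : relocate s e d y a s = y := by
  rw [relocate, if_neg (by omega), if_neg (by omega), if_pos rfl]

theorem relocate_head {s e d y a : ℕ} (h : s + 1 ≤ e) : relocate s e d y a (s + 1) = a := by
  rw [relocate, if_neg (by omega), if_neg (by omega), if_neg (by omega), if_pos rfl]

/-- The block of an abstraction, copied by the program, contains the layout of its body, with the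
defined variables renamed and the argument substituted for the bound variable.  The copy of the
leftmost node is not used as a node: the node `a` of the application replaces it. -/
theorem copied_body {m m' ρ ρ' α : ℕ → ℕ} {s e D ya a x₁ y : ℕ} {B E' : Env} {b' : Bite}
    (hs : 25 ≤ s) (he : e = s + Env.cellLength B)
    (hc : ContainsAt m (s + 1)
      (Env.cells (bind (Function.update ρ x₁ s) B (Env.nodes (s + 1) B)) 0 (s + 1) B))
    (hcopy : ∀ i, s < i → i ≤ e → m' (i + D) = relocate s e D ya a (m i))
    (hα : ∀ z ∉ Env.dom B, α z = z) (hinj : Set.InjOn α (Env.dom B))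
    (hfresh : ∀ z ∈ Env.dom B, α z ∉ Bite.names (.lam x₁ B))
    (hB : Env.subst x₁ y (Env.renameDom α B) = (none, b') :: E')
    (hin : ∀ w ∈ Env.dom E',
      ρ' w = bind ρ E' (Env.nodes (s + 5 + D + Bite.blockLength b') E') w)
    (hout : ∀ w ∉ Env.dom E', ρ' w = ρ w) (hρ : ∀ w, ρ w < s ∨ e < ρ w)
    (hy : ρ' y = ya) (hybn : y ∉ Env.bn B) :
    ContainsAt m' (s + 2 + D) (Bite.cells ρ' (s + 1 + D) b') ∧
    ContainsAt m' (s + 5 + D + Bite.blockLength b')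
      (Env.cells ρ' a (s + 5 + D + Bite.blockLength b') E') ∧
    relocate s e D ya a ((Env.nodes (s + 1) B).getLastD 0) =
      (Env.nodes (s + 5 + D + Bite.blockLength b') E').getLastD a ∧
    Env.cellLength B = 4 + Bite.blockLength b' + Env.cellLength E' := by
  simp only [Bite.names, Finset.mem_insert, not_or] at hfresh
  rw [cells_renameDom hα hinj fun z hz => (hfresh z hz).2, ← nodes_renameDom α] at hc
  have hcl := cellLength_renameDom α B
  have hbn : Env.bn (Env.renameDom α B) = Env.bn B := by
    rw [Env.renameDom, bn_map_names, bn_rename.2]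
  have hdl := Env.domList_renameDom α B
  rw [← nodes_renameDom α]
  generalize Env.renameDom α B = E₂ at hB hc hcl hbn hdl
  obtain _ | ⟨⟨z₂, b₂⟩, E₂⟩ := E₂
  · simp [Env.subst, Env.rename] at hB
  simp only [Env.subst, Env.rename, List.cons.injEq, Prod.mk.injEq] at hB
  obtain ⟨⟨rfl, rfl⟩, rfl⟩ := hB
  set θ : ℕ → ℕ := Function.update id x₁ y with hθ
  simp only [length_rename.1, length_rename.2, nodes_rename, Env.dom_rename] at *
  simp only [Env.cellLength] at hcl
  set l := Bite.blockLength b₂ with hl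
  set f := relocate s e D ya a with hf
  set ρ₂ := bind (Function.update ρ x₁ s) ((none, b₂) :: E₂)
    (Env.nodes (s + 1) ((none, b₂) :: E₂)) with hρ₂
  have hfresh₂ : ∀ w ∈ Env.dom E₂, w ≠ x₁ := by
    intro w hw
    have hw' : w ∈ Env.domList ((none, b₂) :: E₂) := by
      rw [Env.mem_domList, Env.dom_cons]; simp [hw]
    rw [hdl, List.mem_map] at hw'
    obtain ⟨z, hz, rfl⟩ := hw'
    exact (hfresh z (Env.mem_domList.1 hz)).1
  have hnodes : Env.nodes (s + 5 + D + l) E₂ = (Env.nodes (s + 5 + l) E₂).map (· + D) := by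
    rw [← nodes_shift id, rename_id.2]
    congr 1
    omega
  have hnode_f : ∀ n ∈ Env.nodes (s + 5 + l) E₂, f n = n + D := by
    intro n hn
    have := nodes_bounds hn
    exact relocate_inside (by omega) (by omega)
  -- `f` moves addresses along the substitution
  have hkey : ∀ u, ρ' (θ u) = f (ρ₂ u) := by
    intro u
    have hu₂ : ρ₂ u = bind (Function.update ρ x₁ s) E₂ (Env.nodes (s + 5 + l) E₂) u := by
      rw [hρ₂]
      simp only [Env.nodes, bind]
      congr 2
    have hlen : E₂.length = (Env.nodes (s + 5 + l) E₂).length := (length_nodes _ _).symm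
    by_cases hu : u ∈ Env.dom E₂
    · rw [hθ, Function.update_of_ne (hfresh₂ u hu), id, hin u hu, hu₂,
        hnode_f _ (bind_mem hu hlen), hnodes,
        ← bind_map (ρ := Function.update ρ x₁ s) (ρ' := ρ) (g := (· + D)) hu hlen]
      exact congrFun (bind_congr _ (by simp [Env.rename_eq_map])) u
    · rw [hu₂, bind_of_notMem _ hu]
      by_cases hux : u = x₁
      · subst hux
        rw [hθ, Function.update_self, Function.update_self, hy, hf, relocate_param (by omega)]
      · rw [hθ, Function.update_of_ne hux, Function.update_of_ne hux, id, hout u hu]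
        rcases hρ u with h | h
        · rw [hf, relocate_below h]
        · rw [hf, relocate_above h]
  have hcap : ∀ u, θ u = u ∨ θ u ∉ Env.bn ((none, b₂) :: E₂) := by
    intro u
    by_cases hux : u = x₁
    · right
      rw [hux, hθ, Function.update_self, hbn]
      exact hybn
    · left
      rw [hθ, Function.update_of_ne hux, id]
  -- no address of a tag lies in the block, as the working cells precede it
  have hreloc := cells_rename (f := f) (δ := D) (relocate_below (by omega))
    (relocate_below (by omega)) (relocate_below (by omega))
  simp only [Env.cells, ContainsAt, containsAt_append, length_cells.1] at hc
  obtain ⟨-, hc₁, hc₂⟩ := hc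
  refine ⟨?_, ?_, ?_, by omega⟩
  · have h1 := hc₁.map (d := D) (f := f) (m' := m') fun i hi hi' => by
      rw [length_cells.1] at hi'
      exact hcopy i (by omega) (by omega)
    rw [hreloc.1 b₂ ρ₂ ρ' θ (s + 1)
      (fun i hi hi' => relocate_inside (by omega) (by omega)) (fun w _ => hkey w)
      (fun w _ => (hcap w).imp id fun h h' => h (by simp [Env.bn, h']))] at h1
    exact h1
  · have h1 := hc₂.map (d := D) (f := f) (m' := m') fun i hi hi' => by
      rw [length_cells.2] at hi'
      exact hcopy i (by omega) (by omega)
    rw [hreloc.2 E₂ ρ₂ ρ' θ (s + 1) (s + 1 + 4 + l)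
      (fun i hi hi' => relocate_inside (by omega) (by omega)) (fun w _ => hkey w)
      (fun w _ => (hcap w).imp id fun h h' => h (by simp [Env.bn, h'])),
      hf, relocate_head (by omega)] at h1
    rwa [show s + 1 + 1 + (3 + Bite.blockLength b₂) + D = s + 5 + D + l by omega,
      show s + 1 + 4 + l + D = s + 5 + D + l by omega] at h1
  · rw [hnodes, ← List.map_congr_left hnode_f]
    simp only [Env.nodes, List.getLastD_cons]
    rw [show s + 1 + 4 + Bite.blockLength b₂ = s + 5 + l by omega, ← map_getLastD f, hf,
      relocate_head (by omega)]

/-- The transition `m1`.  The node of the application receives the leftmost bite of the copied body,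
and the other copied nodes become new active nodes to its right. -/
theorem Layout.enter {m m' : ℕ → ℕ} {E₁ Ev E' B : Env} {H : List HistEntry} {z : Option ℕ}
    {x y x₁ : ℕ} {b' : Bite} {α : ℕ → ℕ} {as bs : List ℕ} {a N s e : ℕ}
    (h : Layout m ⟨E₁ ++ [(z, .app x y)], Ev, H⟩ (as ++ [a]) bs)
    (hg : Good N (E₁ ++ (z, .app x y) :: Ev))
    (hx : Ev.lookup (some x) = some (.lam x₁ B))
    (hα : FreshRenaming α (Env.dom B) (E₁ ++ (z, .app x y) :: Ev))
    (hB : Env.subst x₁ y (Env.renameDom α B) = (none, b') :: E')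
    {ρ : ℕ → ℕ} (hρ : ρ = State.addr ⟨E₁ ++ [(z, .app x y)], Ev, H⟩ (as ++ [a]) bs)
    (he : e = s + Env.cellLength B)
    (hc : ContainsAt m (s + 1)
      (Env.cells (bind (Function.update ρ x₁ s) B (Env.nodes (s + 1) B)) 0 (s + 1) B))
    (hF : ∀ i, s ≤ i → i ≤ e → Frozen (m 3) (as ++ [a] ++ bs) i)
    (hlast : m (ρ x + 3) = (Env.nodes (s + 1) B).getLastD 0)
    (hm : EnterEffect m m' s e (ρ x) (ρ y)) :
    ∃ ns, Layout m' ⟨E₁ ++ (z, b') :: E', Ev, some (x, y) :: H⟩ (as ++ a :: ns) bs := by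
  set D := m 3 - s with hD
  set ns := Env.nodes (s + 5 + D + Bite.blockLength b') E' with hns
  have hlist : as ++ [a] ++ bs = as ++ a :: bs := by simp
  have hlist' : as ++ a :: ns ++ bs = as ++ a :: (ns ++ bs) := by simp
  have henv' : E₁ ++ (z, b') :: E' ++ Ev = E₁ ++ (z, b') :: (E' ++ Ev) := by simp
  have henv : E₁ ++ [(z, Bite.app x y)] ++ Ev = E₁ ++ (z, Bite.app x y) :: Ev := by simp
  have hlenA : E₁.length = as.length := by simpa using h.length_act
  have hlenN : E'.length = ns.length := (length_nodes _ _).symm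
  have hseg := h.act
  simp only [List.reverse_append, List.reverse_cons, List.reverse_nil, List.nil_append,
    List.cons_append, Segment] at hseg
  obtain ⟨h0, ha0, hseg⟩ := hseg
  have hxmem := mem_of_lookup hx
  have hrange := h.range
  have hsep := h.sep
  have hs25 : 25 ≤ s := (hF s le_rfl (by omega)).1
  have he3 : e < m 3 := (hF e (by omega) le_rfl).2.1
  -- the addresses of the old and of the new variables
  set ρ' := State.addr ⟨E₁ ++ (z, b') :: E', Ev, some (x, y) :: H⟩ (as ++ a :: ns) bs with hρ'
  have hfresh : ∀ w ∈ Env.dom E', w ∉ Env.names (E₁ ++ (z, Bite.app x y) :: Ev) := by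
    intro w hw
    have hdl : Env.domList E' = (Env.domList B).map α := by
      have := congrArg Env.domList hB
      rw [Env.subst, Env.domList_rename, Env.domList_renameDom, Env.domList_cons] at this
      simpa using this.symm
    rw [← Env.mem_domList, hdl, List.mem_map] at hw
    obtain ⟨v, hv, rfl⟩ := hw
    exact hα.2.2 v (Env.mem_domList.1 hv)
  have hout : ∀ w ∉ Env.dom E', ρ' w = ρ w := by
    intro w hw
    rw [hρ', hρ]
    simp only [State.addr]
    rw [hlist, hlist', henv, henv']
    exact bind_insert_of_notMem hlenA hlenN hw
  have hold : ∀ w ∈ Env.names (E₁ ++ (z, Bite.app x y) :: Ev), ρ' w = ρ w := fun w hw =>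
    hout w fun hw' => hfresh w hw' hw
  have hin : ∀ w ∈ Env.dom E', ρ' w = bind ρ E' ns w := by
    intro w hw
    rw [hρ']
    simp only [State.addr]
    rw [hlist', henv']
    refine bind_insert_of_mem hlenA hlenN hw fun hw' => hfresh w hw ?_
    refine Env.dom_subset_names _ ?_
    simp only [Env.dom_append, Env.dom_cons, Finset.mem_union] at hw' ⊢
    rcases hw' with hw' | hw' | hw'
    · exact Or.inl hw'
    · exact Or.inr (Or.inl hw')
    · simp at hw'
  have hydom : y ∈ Env.dom (E₁ ++ (z, Bite.app x y) :: Ev) :=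
    hg.closed (Env.mem_occ.2 ⟨(z, .app x y), by simp, by simp [Bite.occ]⟩)
  have hxdom : x ∈ Env.dom (E₁ ++ (z, Bite.app x y) :: Ev) :=
    Env.mem_dom.2 ⟨.lam x₁ B, by simp [hxmem]⟩
  have hρs : ∀ w, ρ w < s ∨ e < ρ w := by
    intro w
    by_contra hcon
    refine h.addr_not_frozen w ?_
    rw [← hρ]
    exact hF _ (by omega) (by omega)
  obtain ⟨hc₁, hc₂, hlast', hlen⟩ := copied_body (m := m) (m' := m') (ρ := ρ) (ρ' := ρ')
    (ya := ρ y) (a := a) (D := D) hs25 he hc (fun i hi hi' => by rw [hm.copy i hi hi', h0])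
    hα.1 hα.2.1
    (fun v hv hv' => hα.2.2 v hv (Env.names_of_mem (z := some x) (b := .lam x₁ B)
      (by simp [hxmem]) hv'))
    hB hin hout hρs (hold y (Env.dom_subset_names _ hydom))
    (fun hy => hg.dom_bn y hydom (Env.mem_bn.2
      ⟨(some x, .lam x₁ B), by simp [hxmem], by simp [Bite.bn, hy]⟩))
  -- the new nodes lie beyond all old cells
  have hnsb : ∀ n ∈ ns, s + 5 + D + Bite.blockLength b' ≤ n ∧ n + 4 ≤ e + D + 1 := by
    intro n hn
    have := nodes_bounds hn
    omega
  have hfree := hm.free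
  have hnode : ∀ n' ∈ as ++ bs, (n' + 4 ≤ a ∨ a + 4 ≤ n') := by
    intro n' hn'
    rw [List.append_assoc, List.pairwise_append] at hsep
    simp only [List.cons_append, List.nil_append, List.pairwise_cons] at hsep
    rcases List.mem_append.1 hn' with hn' | hn'
    · exact hsep.2.2 n' hn' a (by simp)
    · exact (hsep.2.1.1 n' hn').symm
  have hkeep : ∀ n' ∈ as ++ bs, ∀ i, i ≤ 3 → m' (n' + i) = m (n' + i) := by
    intro n' hn' i hi
    have h1 := hnode n' hn'
    have h2 := hrange n' (by simp only [List.mem_append] at hn' ⊢; tauto)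
    exact hm.rest _ (by omega) (by omega) (by omega)
  have ha := hrange a (by simp)
  have hma : m' a = m a := hm.rest a (by omega) (by omega) (by omega)
  have hmem : ∀ n, n ∈ as ++ a :: (ns ++ bs) ↔ n ∈ as ++ [a] ++ bs ∨ n ∈ ns := fun n => by
    simp only [List.mem_append, List.mem_cons, List.not_mem_nil]
    tauto
  have hF' : ∀ i, Frozen (m 3) (as ++ [a] ++ bs) i →
      m' i = m i ∧ Frozen (m' 3) (as ++ a :: (ns ++ bs)) i := by
    rintro i ⟨h1, h2, h3⟩
    have := h3 a (by simp)
    refine ⟨hm.rest i h1 h2 (by omega), h1, by omega, fun n hn => ?_⟩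
    rcases (hmem n).1 hn with hn | hn
    · exact h3 n hn
    · have := hnsb n hn
      omega
  -- so do the copied blocks and the history entry
  have hFnew : ∀ i, m 3 ≤ i → i < e + D + 4 → (∀ n ∈ ns, i < n ∨ n + 4 ≤ i) →
      Frozen (m' 3) (as ++ a :: (ns ++ bs)) i := by
    intro i hi hi' hi''
    refine ⟨by omega, by omega, fun n hn => ?_⟩
    rcases (hmem n).1 hn with hn | hn
    · have := hrange n hn
      omega
    · exact hi'' n hn
  refine ⟨ns, ?_⟩
  constructor
  · simp [hlenA, hlenN]
  · simp [h.length_ev]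
  · rw [hlist']
    have hp : (as ++ a :: (ns ++ bs)).Perm (as ++ [a] ++ bs ++ ns) := by
      simp only [List.append_assoc, List.cons_append, List.nil_append]
      exact List.Perm.append_left _ (List.Perm.cons _ List.perm_append_comm)
    rw [hp.pairwise_iff (fun hpq => hpq.symm), List.pairwise_append]
    refine ⟨hsep, (nodes_pairwise _ E').imp fun h => Or.inl h, fun p hp q hq => ?_⟩
    have := hrange p hp
    have := hnsb q hq
    omega
  · intro n hn
    rw [hlist'] at hn
    rcases (hmem n).1 hn with hn | hn
    · have := hrange n hn
      omega
    · have := hnsb n hn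
      omega
  · omega
  · exact hm.zero
  · have hrev : (as ++ a :: ns).reverse = ns.reverse ++ (a :: as.reverse) := by simp
    rw [hrev, hm.act, h0, hlast, hlast']
    refine segment_append.2 ⟨a, segment_of_cells (by omega) hc₂, rfl, ha0, ?_⟩
    rw [hma]
    exact hseg.congr fun n hn => hkeep n (by simpa using Or.inl hn) 0 (by omega)
  · rw [hm.ev]
    exact h.ev.congr fun n hn => hkeep n (by simp [hn]) 0 (by omega)
  · have hst := h.stored
    rw [List.zip_append h.length_act, List.zip_append hlenA, ← hρ] at hst
    rw [hlist', henv', List.zip_append hlenA]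
    simp only [List.zip_cons_cons, List.zip_append hlenN, List.mem_append, List.mem_cons]
    rintro p (hp | rfl | hp | hp)
    · refine (hst p (by simp [hp])).transfer hF'
        (fun i _ hi => hkeep _ (by simp [(List.of_mem_zip hp).2]) i hi) fun w hw => hold w ?_
      exact Env.names_of_mem (z := p.1.1) (by simp [(List.of_mem_zip hp).1]) hw
    · rw [← List.take_append_drop 3 (Bite.cells ρ' _ b'), containsAt_append] at hc₁
      have h3 : ((Bite.cells ρ' (s + 1 + D) b').take 3).length = 3 := by simp [length_cells.1]
      rw [h3] at hc₁
      refine ⟨s + 1 + D, hc₁.1.move fun i hi => ?_, ?_, fun i hi hi' => ?_⟩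
      · rw [h3] at hi
        have h1 := hm.bite (1 + i) (by omega) (by omega)
        have h2 := hm.copy (s + 1 + (1 + i)) (by omega) (by omega)
        rw [h0] at h1 h2
        rw [show a + 1 + i = a + (1 + i) by omega, h1, ← h2]
        congr 1
        omega
      · rw [show s + 1 + D + 4 = s + 2 + D + 3 by omega]
        exact hc₁.2
      · simp only at hi'
        refine hFnew i (by omega) (by omega) fun n hn => ?_
        have := hnsb n hn
        omega
    · obtain ⟨a', g1, g2, g3⟩ := stored_of_cells hc₂ p hp
      refine ⟨a', g1, g2, fun i hi hi' => ?_⟩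
      obtain ⟨k1, k2, k3⟩ := g3 i hi hi'
      exact hFnew i (by omega) (by omega) k3
    · refine (hst p (by simp [hp])).transfer hF'
        (fun i _ hi => hkeep _ (by simp [(List.of_mem_zip hp).2]) i hi) fun w hw => hold w ?_
      exact Env.names_of_mem (z := p.1.1) (by simp [(List.of_mem_zip hp).1]) hw
  · have hD' : Env.dom (E₁ ++ (z, Bite.app x y) :: Ev) ⊆
        Env.dom (E₁ ++ (z, b') :: (E' ++ Ev)) := by
      intro w hw
      simp only [Env.dom_append, Env.dom_cons, Finset.mem_union] at hw ⊢
      tauto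
    have hh := h.hist
    simp only [henv, ← hρ] at hh
    have hFh : ∀ i, i < 3 → Frozen (m' 3) (as ++ a :: (ns ++ bs)) (e + D + 1 + i) :=
      fun i hi => hFnew _ (by omega) (by omega) fun n hn => by
        have := hnsb n hn
        omega
    rw [hlist', henv', ← hρ']
    simp only [HistStored]
    rw [hm.hist, show e + (m 3 - s) + 1 + 1 = e + (m 3 - s) + 2 by omega,
      show e + (m 3 - s) + 1 + 2 = e + (m 3 - s) + 3 by omega, hm.hist_fst, hm.hist_snd,
      hm.hist_link]
    refine ⟨by omega, hFh 0 (by omega), hFh 1 (by omega), hFh 2 (by omega),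
      ⟨hD' hxdom, hD' hydom, (hold x (Env.dom_subset_names _ hxdom)).symm,
        (hold y (Env.dom_subset_names _ hydom)).symm⟩,
      hh.transfer hF' hD' fun w hw => hold w (Env.dom_subset_names _ hw)⟩

/-! ### Simulation of a single transition -/

/-- The program is at the head of its main loop, and the state and the memory satisfy the
invariants. -/
def Simulates (N : ℕ) (c : Config) (S : State) : Prop :=
  c.pc = 0 ∧ Good N (S.act ++ S.ev) ∧ ∃ as bs, Layout c.mem S as bs

/-- Cell `0` contains the address of the rightmost active node. -/
theorem Layout.exists_last {m : ℕ → ℕ} {E₁ Ev : Env} {H : List HistEntry} {z : Option ℕ}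
    {b : Bite} {as bs : List ℕ} (h : Layout m ⟨E₁ ++ [(z, b)], Ev, H⟩ as bs) :
    ∃ as₁, as = as₁ ++ [m 0] ∧
      Stored m (State.addr ⟨E₁ ++ [(z, b)], Ev, H⟩ as bs) (Frozen (m 3) (as ++ bs)) b (m 0) := by
  obtain rfl | ⟨as₁, a, rfl⟩ := List.eq_nil_or_concat' as
  · simpa using h.length_act
  · have hseg := h.act
    simp only [List.reverse_append, List.reverse_cons, List.reverse_nil, List.nil_append,
      List.cons_append, Segment] at hseg
    obtain ⟨h0, -, -⟩ := hseg
    have hl : E₁.length = as₁.length := by simpa using h.length_act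
    refine ⟨as₁, by rw [h0], ?_⟩
    rw [h0]
    refine h.stored ((z, b), a) ?_
    rw [List.zip_append h.length_act, List.zip_append hl]
    simp

theorem run_one_of_ne_zero {m : ℕ → ℕ} (h : m 0 ≠ 0) : machine.run ⟨0, m⟩ 1 = ⟨1, m⟩ := by
  simp [Program.run, Program.step, machine, Instr.exec, h]

theorem Stored.app {m ρ : ℕ → ℕ} {F : ℕ → Prop} {x y n : ℕ} (h : Stored m ρ F (.app x y) n) :
    m (n + 1) = 0 ∧ m (n + 2) = ρ x ∧ m (n + 3) = ρ y := by
  obtain ⟨a, h1, -, -⟩ := h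
  simpa [Bite.cells, ContainsAt] using h1

theorem Stored.tag_ne_zero {m ρ : ℕ → ℕ} {F : ℕ → Prop} {v : Bite} {n : ℕ} (hv : v.IsValue)
    (h : Stored m ρ F v n) : m (n + 1) ≠ 0 := by
  obtain ⟨a, h1, -, -⟩ := h
  cases v with
  | app x y => exact hv.elim
  | ret x y =>
    simp only [Bite.cells, List.take_succ_cons, ContainsAt] at h1
    omega
  | lam x E =>
    simp only [Bite.cells, List.cons_append, List.take_succ_cons, ContainsAt] at h1
    omega

theorem simulates_search {N : ℕ} {m : ℕ → ℕ} {E₁ Ev : Env} {H : List HistEntry} {x : Option ℕ}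
    {v : Bite} (hv : v.IsValue) (h : Simulates N ⟨0, m⟩ ⟨E₁ ++ [(x, v)], Ev, H⟩) :
    m 0 ≠ 0 ∧ Reaches ⟨1, m⟩ 22 fun c => Simulates N c ⟨E₁, (x, v) :: Ev, none :: H⟩ := by
  obtain ⟨-, hg, as, bs, hl⟩ := h
  simp only at hg hl
  obtain ⟨as, rfl, hst⟩ := hl.exists_last
  have h0 := hl.range (m 0) (by simp)
  refine ⟨by omega, (reaches_search h0.1 h0.2 hl.zero (hst.tag_ne_zero hv)).trans (N' := 0)
    fun c hc => .refl ⟨hc.1, by simpa using hg, as, m 0 :: bs, ?_⟩⟩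
  exact hl.move hst ⟨rfl, rfl⟩ hc.2

theorem simulates_return {N : ℕ} {m : ℕ → ℕ} {E₁ Ev : Env} {H : List HistEntry} {z : Option ℕ}
    {x y x₁ y₁ : ℕ} {v : Bite} (hx : Ev.lookup (some x) = some (.ret x₁ y₁))
    (hv : Ev.lookup (some (Function.update id x₁ y y₁)) = some v)
    (h : Simulates N ⟨0, m⟩ ⟨E₁ ++ [(z, .app x y)], Ev, H⟩) :
    m 0 ≠ 0 ∧ Reaches ⟨1, m⟩ 50 fun c =>
      Simulates N c ⟨E₁, (z, v) :: Ev, some (x, y) :: H⟩ := by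
  obtain ⟨-, hg, as, bs, hl⟩ := h
  simp only at hg hl
  obtain ⟨as, rfl, hst⟩ := hl.exists_last
  set ρ := State.addr ⟨E₁ ++ [(z, .app x y)], Ev, H⟩ (as ++ [m 0]) bs with hρ
  obtain ⟨htag, hfn, harg⟩ := hst.app
  obtain ⟨hxd, hxb, hxs⟩ := hl.lookup hg.nodup hx
  obtain ⟨-, hvb, hvs⟩ := hl.lookup hg.nodup hv
  rw [← hρ] at hxb hxs hvb hvs
  have h0 := hl.range (m 0) (by simp)
  have hxr := hl.range (ρ x) (by simp [hxb])
  have hvr := hl.range _ (List.mem_append_right _ hvb)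
  have hsep := hl.sep
  simp only [List.append_assoc, List.cons_append, List.nil_append, List.pairwise_append,
    List.pairwise_cons] at hsep
  have hsep' := hsep.2.1.1 _ hvb
  have hyd : y ∈ Env.dom (E₁ ++ [(z, .app x y)] ++ Ev) :=
    hg.closed (Env.mem_occ.2 ⟨(z, .app x y), by simp, by simp [Bite.occ]⟩)
  obtain ⟨a, g1, -, g3⟩ := hxs
  simp only [Bite.cells, List.take_succ_cons, List.take_zero, ContainsAt, and_true] at g1
  obtain ⟨g11, g12, g13⟩ := g1
  -- the free variable of a constant function does not have the address of the bound variable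
  have hne : ρ y₁ ≠ a + 4 := fun heq => hl.addr_not_frozen y₁ (by
    rw [← hρ, heq]
    exact g3 (a + 4) le_rfl (by simp [Bite.blockLength]))
  have hn : ρ (Function.update id x₁ y y₁) = if m (m (m 0 + 2) + 3) = m (m (m 0 + 2) + 2) then
      m (m 0 + 3) else m (m (m 0 + 2) + 3) := by
    rw [hfn, harg, show ρ x + 3 = ρ x + 1 + 1 + 1 by rfl, show ρ x + 2 = ρ x + 1 + 1 by rfl,
      g12, g13]
    by_cases hy : y₁ = x₁
    · subst hy; simp
    · simp [hy, hne]
  refine ⟨by omega, (reaches_return h0.1 h0.2 hl.zero htag (by omega) (by rw [hfn, g11]) hn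
    hvr.1 hsep'.symm).trans (N' := 0) fun c hc => .refl ⟨hc.1, ?_, as, m 0 :: bs, ?_⟩⟩
  · have hg' : Good N (E₁ ++ (z, .app x y) :: Ev) := by simpa using hg
    exact hg'.replace (mem_of_lookup hv)
  · exact hl.move hvs ⟨hxd, hyd, hfn, harg⟩ hc.2

theorem simulates_enter {N : ℕ} {m : ℕ → ℕ} {E₁ Ev E' B : Env} {H : List HistEntry}
    {z : Option ℕ} {x y x₁ : ℕ} {b' : Bite} {α : ℕ → ℕ}
    (hx : Ev.lookup (some x) = some (.lam x₁ B))
    (hα : FreshRenaming α (Env.dom B) (E₁ ++ (z, .app x y) :: Ev))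
    (hB : Env.subst x₁ y (Env.renameDom α B) = (none, b') :: E')
    (h : Simulates N ⟨0, m⟩ ⟨E₁ ++ [(z, .app x y)], Ev, H⟩) :
    m 0 ≠ 0 ∧ Reaches ⟨1, m⟩ (20 * N + 70) fun c =>
      Simulates N c ⟨E₁ ++ (z, b') :: E', Ev, some (x, y) :: H⟩ := by
  obtain ⟨-, hg, as, bs, hl⟩ := h
  simp only at hg hl
  obtain ⟨as, rfl, hst⟩ := hl.exists_last
  obtain ⟨htag, hfn, harg⟩ := hst.app
  obtain ⟨hxd, hxb, hxs⟩ := hl.lookup hg.nodup hx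
  obtain ⟨ρ, hρ⟩ : ∃ ρ, ρ = State.addr ⟨E₁ ++ [(z, .app x y)], Ev, H⟩ (as ++ [m 0]) bs :=
    ⟨_, rfl⟩
  rw [← hρ] at hxb hxs hfn harg
  have h0 := hl.range (m 0) (by simp)
  have hxr := hl.range (ρ x) (by simp [hxb])
  have hg' : Good N (E₁ ++ (z, .app x y) :: Ev) := by simpa using hg
  have hsize := hg.size (some x, .lam x₁ B) (by simp [mem_of_lookup hx])
  obtain ⟨a, g1, g2, g3⟩ := hxs
  simp only [Bite.cells, List.cons_append, List.nil_append, List.take_succ_cons, List.take_zero,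
    List.drop_succ_cons, List.drop_zero, ContainsAt, and_true] at g1 g2
  obtain ⟨g11, g12, g13⟩ := g1
  obtain ⟨g21, g22⟩ := g2
  simp only [Bite.blockLength] at g3 hsize
  have hF : ∀ i, a + 4 ≤ i → i ≤ a + 4 + Env.cellLength B →
      Frozen (m 3) (as ++ [m 0] ++ bs) i := fun i hi hi' => g3 i hi (by omega)
  have hpos : 4 ≤ Env.cellLength B := by
    cases B with
    | nil => simp [Env.renameDom, Env.rename, Env.subst] at hB
    | cons e B => obtain ⟨z', b⟩ := e; simp only [Env.cellLength]; omega
  have hnode : (Env.nodes (a + 5) B).getLastD 0 ∈ Env.nodes (a + 5) B := by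
    cases B with
    | nil => simp [Env.cellLength] at hpos
    | cons e B =>
      obtain ⟨z', b⟩ := e
      simp only [Env.nodes, List.getLastD_cons]
      exact List.getLastD_mem_cons
  have hnode' := nodes_bounds hnode
  have hs := hF (a + 4) le_rfl (by omega)
  have he := hF (a + 4 + Env.cellLength B) (by omega) le_rfl
  have hr := reaches_enter (m := m) (s := a + 4) (e := a + 4 + Env.cellLength B) h0.1 h0.2
    hl.zero htag (by omega) (by rw [hfn, g11]) (by rw [hfn]; exact g12) g21 hs.1 (by omega)
    he.2.1 (by rw [hfn]; change _ < m (ρ x + 1 + 1 + 1); omega)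
    (by rw [hfn]; change m (ρ x + 1 + 1 + 1) ≤ _; omega)
  obtain ⟨n, hn, hc⟩ := hr
  refine ⟨by omega, n, by omega, hc.1, ?_, ?_⟩
  · simpa using hg'.enter (mem_of_lookup hx) hα hB
  · rw [hfn, harg] at hc
    obtain ⟨ns, hns⟩ := hl.enter hg' hx hα hB hρ rfl g22 hF g13 hc.2
    exact ⟨_, _, hns⟩

/-! ### The crumbling of a term satisfies the syntactic invariant -/

theorem domList_assign (n : ℕ) (b : Bite) (E : Env) :
    Env.domList (Env.assign n ((none, b) :: E)) = n :: Env.domList ((none, b) :: E) := by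
  simp [Env.assign, Env.domList_cons]

/-- What is known of the crumbling of a term `t`, when the fresh names are taken from `n`
onwards. -/
structure CrumbSpec (t : Term) (n : ℕ) (r : Env × ℕ) : Prop where
  le : n ≤ r.2
  head : (∀ x, t ≠ .var x) → ∃ b E, r.1 = (none, b) :: E
  dom : ∀ w ∈ Env.domList r.1, n ≤ w ∧ w < r.2
  nodup : (Env.domList r.1).Nodup
  bn : ∀ w ∈ Env.bn r.1, w < t.bound ∨ n ≤ w ∧ w < r.2
  dom_bn : ∀ w ∈ Env.domList r.1, w ∉ Env.bn r.1
  occ : (∀ x, t ≠ .var x) → ∀ w ∈ Env.occ r.1, w ∈ t.fv ∨ w ∈ Env.domList r.1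
  wf : Env.WF r.1
  length : Env.cellLength r.1 ≤ 5 * t.size

theorem bn_assign (n : ℕ) (E : Env) : Env.bn (Env.assign n E) = Env.bn E := by
  cases E with
  | nil => rfl
  | cons e E => simp [Env.assign, Env.bn]

theorem occ_assign (n : ℕ) (E : Env) : Env.occ (Env.assign n E) = Env.occ E := by
  cases E with
  | nil => rfl
  | cons e E => simp [Env.assign, Env.occ]

theorem wf_assign (n : ℕ) (E : Env) : Env.WF (Env.assign n E) ↔ Env.WF E := by
  cases E with
  | nil => rfl
  | cons e E => simp [Env.assign, Env.WF]

theorem cellLength_assign (n : ℕ) (E : Env) :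
    Env.cellLength (Env.assign n E) = Env.cellLength E := by
  cases E with
  | nil => rfl
  | cons e E => simp [Env.assign, Env.cellLength]

theorem bn_append (E F : Env) : Env.bn (E ++ F) = Env.bn E ∪ Env.bn F := by
  ext w; simp only [Env.mem_bn, Finset.mem_union, List.mem_append, or_and_right, exists_or]

theorem occ_append (E F : Env) : Env.occ (E ++ F) = Env.occ E ∪ Env.occ F := by
  ext w; simp only [Env.mem_occ, Finset.mem_union, List.mem_append, or_and_right, exists_or]

theorem wf_append (E F : Env) : Env.WF (E ++ F) ↔ Env.WF E ∧ Env.WF F := by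
  simp only [Env.wf_iff, List.mem_append, or_imp, forall_and]

theorem cellLength_append : ∀ E F : Env,
    Env.cellLength (E ++ F) = Env.cellLength E + Env.cellLength F
  | [], F => by simp [Env.cellLength]
  | (z, b) :: E, F => by
      simp only [List.cons_append, Env.cellLength, cellLength_append E F]; omega

/-- The case of an application of which exactly one side, `u`, is not a variable. -/
theorem CrumbSpec.one {t u : Term} {n : ℕ} {r : Env × ℕ} (h : CrumbSpec u (n + 1) r)
    (hu : ∀ x, u ≠ .var x) {b : Bite} (hbn : Bite.bn b = ∅) (hwf : Bite.WF b)
    (hl : Bite.blockLength b = 0)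
    (hbound : u.bound ≤ t.bound) (ht : t.bound ≤ n) (hfv : u.fv ⊆ t.fv)
    (hocc : ∀ w ∈ Bite.occ b, w ∈ t.fv ∨ w = n) (hsize : u.size + 1 ≤ t.size) :
    CrumbSpec t n ((none, b) :: Env.assign n r.1, r.2) := by
  obtain ⟨b', E, hE⟩ := h.head hu
  have hd : Env.domList ((none, b) :: Env.assign n r.1) = n :: Env.domList r.1 := by
    rw [Env.domList_cons, hE, domList_assign]; rfl
  constructor
  · have := h.le; simp only; omega
  · exact fun _ => ⟨_, _, rfl⟩
  · intro w hw
    have := h.le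
    rw [hd, List.mem_cons] at hw
    rcases hw with rfl | hw
    · simp only; omega
    · have := h.dom w hw; simp only; omega
  · rw [hd, List.nodup_cons]
    refine ⟨fun hn => ?_, h.nodup⟩
    have := h.dom n hn
    omega
  · intro w hw
    simp only [Env.bn, bn_assign, hbn, Finset.empty_union] at hw
    have := h.bn w hw
    simp only; omega
  · intro w hw hw'
    simp only [Env.bn, bn_assign, hbn, Finset.empty_union] at hw'
    rw [hd, List.mem_cons] at hw
    rcases hw with rfl | hw
    · have := h.bn w hw'
      omega
    · exact h.dom_bn w hw hw'
  · intro _ w hw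
    simp only [Env.occ, occ_assign, Finset.mem_union] at hw
    rw [hd, List.mem_cons]
    rcases hw with hw | hw
    · exact (hocc w hw).imp id Or.inl
    · exact (h.occ hu w hw).imp (fun h => hfv h) Or.inr
  · simp only [Env.WF, wf_assign]; exact ⟨hwf, h.wf⟩
  · have := h.length
    simp only [Env.cellLength, cellLength_assign, hl]; omega

theorem crumbSpec (t : Term) (n : ℕ) (hn : t.bound ≤ n) : CrumbSpec t n (crumbFrom t n) := by
  fun_induction crumbFrom t n with
  | case1 x n =>
    constructor <;> simp [Env.domList, Env.bn, Env.WF, Env.cellLength]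
  | case2 x y n =>
    constructor <;> simp [Env.domList, Env.bn, Env.WF, Env.cellLength, Bite.bn, Bite.WF, Env.occ,
      Bite.occ, Term.bound, Term.fv, Bite.blockLength, Term.size]
  | case3 x t n ht r ih =>
    have ht' : ∀ y, t ≠ .var y := fun y h => ht y h
    simp only [Term.bound] at hn
    have h : CrumbSpec t n r := ih (by omega)
    constructor
    · exact h.le
    · exact fun _ => ⟨_, _, rfl⟩
    · simp [Env.domList]
    · simp [Env.domList]
    · intro w hw
      simp only [Env.bn, Bite.bn, Finset.union_empty, Finset.mem_insert, Finset.mem_union,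
        ← Env.mem_domList] at hw
      simp only [Term.bound]
      rcases hw with rfl | hw | hw
      · omega
      · exact Or.inr (h.dom w hw)
      · have := h.bn w hw
        omega
    · simp [Env.domList]
    · intro _ w hw
      simp only [Env.occ, Bite.occ, Finset.union_empty, Finset.mem_erase, Finset.mem_sdiff,
        ← Env.mem_domList] at hw
      have := h.occ ht' w hw.2.1
      simp only [Term.fv, Finset.mem_erase]
      tauto
    · simp only [Env.WF, Bite.WF, and_true]
      exact ⟨h.nodup, h.wf⟩
    · have := h.length
      simp only [Env.cellLength, Bite.blockLength, Term.size]
      omega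
  | case4 x y n =>
    constructor <;> simp [Env.domList, Env.bn, Env.WF, Env.cellLength, Bite.bn, Bite.WF, Env.occ,
      Bite.occ, Term.fv, Bite.blockLength, Term.size]
  | case5 u y n hu r ih =>
    simp only [Term.bound] at hn
    refine (ih (by omega)).one (fun x h => hu x h) rfl (by simp [Bite.WF]) rfl ?_ ?_ ?_ ?_ ?_
    · simp [Term.bound]
    · simpa [Term.bound] using hn
    · exact Finset.subset_union_left
    · simp only [Bite.occ, Finset.mem_insert, Finset.mem_singleton, Term.fv, Finset.mem_union]
      tauto
    · simp [Term.size]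
  | case6 x u n hu r ih =>
    simp only [Term.bound] at hn
    refine (ih (by omega)).one (fun x h => hu x h) rfl (by simp [Bite.WF]) rfl ?_ ?_ ?_ ?_ ?_
    · simp [Term.bound]
    · simpa [Term.bound] using hn
    · exact Finset.subset_union_right
    · simp only [Bite.occ, Finset.mem_insert, Finset.mem_singleton, Term.fv, Finset.mem_union]
      tauto
    · simp [Term.size]
  | case7 u u' n _ hu' hu r r' ih1 ih2 =>
    simp only [Term.bound] at hn
    have h : CrumbSpec u (n + 2) r := ih1 (by omega)
    have hle := h.le
    have h' : CrumbSpec u' r.2 r' := ih2 (by omega)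
    have hle' := h'.le
    obtain ⟨b₁, E₁, hE₁⟩ := h.head fun x h => hu x h
    obtain ⟨b₂, E₂, hE₂⟩ := h'.head fun x h => hu' x h
    have hd : Env.domList ((none, .app n (n + 1)) :: (Env.assign n r.1 ++ Env.assign (n + 1) r'.1))
        = n :: (Env.domList r.1 ++ (n + 1) :: Env.domList r'.1) := by
      rw [Env.domList_cons, Env.domList_append, hE₁, domList_assign, hE₂, domList_assign]; rfl
    have hb : Env.bn ((none, .app n (n + 1)) :: (Env.assign n r.1 ++ Env.assign (n + 1) r'.1))
        = Env.bn r.1 ∪ Env.bn r'.1 := by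
      simp [Env.bn, bn_append, bn_assign, Bite.bn]
    constructor
    · change n ≤ r'.2; omega
    · exact fun _ => ⟨_, _, rfl⟩
    · intro w hw
      rw [hd] at hw
      simp only [List.mem_cons, List.mem_append] at hw
      rcases hw with rfl | hw | rfl | hw
      · simp only; omega
      · have := h.dom w hw; simp only; omega
      · simp only; omega
      · have := h'.dom w hw; simp only; omega
    · rw [hd]
      simp only [List.nodup_cons, List.nodup_append, List.mem_append, List.mem_cons]
      refine ⟨fun hw => ?_, h.nodup, ⟨fun hw => ?_, h'.nodup⟩, fun a ha b hb => ?_⟩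
      · rcases hw with hw | hw | hw
        · have := h.dom n hw; omega
        · omega
        · have := h'.dom n hw; omega
      · have := h'.dom _ hw; omega
      · have := h.dom a ha
        rcases hb with rfl | hb
        · omega
        · have := h'.dom b hb; omega
    · intro w hw
      rw [hb, Finset.mem_union] at hw
      simp only [Term.bound]
      rcases hw with hw | hw
      · have := h.bn w hw; omega
      · have := h'.bn w hw; omega
    · intro w hw hw'
      rw [hd] at hw
      rw [hb, Finset.mem_union] at hw'
      simp only [List.mem_cons, List.mem_append] at hw
      rcases hw with rfl | hw | rfl | hw <;> rcases hw' with hw' | hw'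
      · have := h.bn _ hw'; omega
      · have := h'.bn _ hw'; omega
      · exact h.dom_bn w hw hw'
      · have := h'.bn _ hw'; have := h.dom _ hw; omega
      · have := h.bn _ hw'; omega
      · have := h'.bn _ hw'; omega
      · have := h.bn _ hw'; have := h'.dom _ hw; omega
      · exact h'.dom_bn w hw hw'
    · intro _ w hw
      rw [hd]
      simp only [Env.occ, occ_append, occ_assign, Bite.occ, Finset.mem_union, Finset.mem_insert,
        Finset.mem_singleton] at hw
      simp only [Term.fv, Finset.mem_union, List.mem_cons, List.mem_append]
      rcases hw with (rfl | rfl) | hw | hw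
      · simp
      · simp
      · have := h.occ (fun x h => hu x h) w hw; tauto
      · have := h'.occ (fun x h => hu' x h) w hw; tauto
    · simp only [Env.WF, wf_append, wf_assign, Bite.WF, true_and]
      exact ⟨h.wf, h'.wf⟩
    · have h1 := h.length
      have h2 := h'.length
      simp only [Env.cellLength, cellLength_append, cellLength_assign, Bite.blockLength,
        Term.size]
      omega

theorem good_crumb {t : Term} (ht : t.Closed) :
    Good (Env.cellLength (crumb t)) (crumb t) := by
  have h := crumbSpec t t.bound le_rfl
  have hne : ∀ x, t ≠ .var x := by
    rintro x rfl
    simp [Term.Closed, Term.fv] at ht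
  refine ⟨h.nodup, fun w hw => h.dom_bn w (Env.mem_domList.2 hw), fun w hw => ?_, h.wf,
    blockLength_le_cellLength⟩
  have := h.occ hne w hw
  rw [ht] at this
  simpa [Env.mem_domList, crumb] using this

/-! ### The initial memory -/

theorem layout_init (E : Env) : Layout (initMem 21 E) (State.init E) (Env.nodes 25 E) [] := by
  set ρ := bind (fun _ => 0) E (Env.nodes 25 E) with hρ
  have h0 : initMem 21 E 0 = (Env.nodes 25 E).getLastD 0 := rfl
  have h3 : initMem 21 E 3 = 25 + Env.cellLength E := rfl
  have hc : ContainsAt (initMem 21 E) 25 (Env.cells ρ 0 25 E) := by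
    refine containsAt_of_getD fun i _ => ?_
    rw [initMem, List.getD_append_right _ _ _ _ (by simp)]
    simp [hρ]
  have haddr : (State.init E).addr (Env.nodes 25 E) [] = ρ := by
    simp [State.addr, State.init, hρ]
  constructor
  · exact (length_nodes _ _).symm
  · rfl
  · simpa using (nodes_pairwise 25 E).imp fun h => Or.inl h
  · intro n hn
    have := nodes_bounds (by simpa using hn)
    rw [h3]
    omega
  · rw [h3]; omega
  · rfl
  · rw [h0]
    exact segment_of_cells (by omega) hc
  · rfl
  · intro p hp
    rw [haddr, h3]
    simp only [State.init, List.append_nil] at hp ⊢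
    exact stored_of_cells hc p hp
  · rfl

/-! ### Executions -/

theorem length_le_cellLength (E : Env) : E.length ≤ Env.cellLength E := by
  induction E with
  | nil => simp
  | cons e E ih =>
    obtain ⟨z, b⟩ := e
    simp only [List.length_cons, Env.cellLength]; omega

/-- One transition: the length of the active environment is a potential that pays for the search
transitions. -/
theorem simulates_step {N : ℕ} {l : Label} {S S' : State} {c : Config} (hS : Step l S S')
    (h : Simulates N c S) : ∃ n, 0 < n ∧ Simulates N (machine.run c n) S' ∧
      n + 71 * S'.act.length ≤ 71 * S.act.length + l.principal * (91 * N + 71) := by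
  obtain ⟨pc, m⟩ := c
  obtain rfl : pc = 0 := h.1
  have key : ∀ k, m 0 ≠ 0 ∧ Reaches ⟨1, m⟩ k (fun c => Simulates N c S') →
      k + 1 + 71 * S'.act.length ≤ 71 * S.act.length + l.principal * (91 * N + 71) →
      ∃ n, 0 < n ∧ Simulates N (machine.run ⟨0, m⟩ n) S' ∧
        n + 71 * S'.act.length ≤ 71 * S.act.length + l.principal * (91 * N + 71) := by
    rintro k ⟨h0, n, hn, hs⟩ hk
    refine ⟨1 + n, by omega, ?_, by omega⟩
    rwa [run_add, run_one_of_ne_zero h0]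
  cases hS with
  | sea E₁ Ev H x v hv =>
    refine key _ (simulates_search hv h) ?_
    simp only [List.length_append, List.length_cons, List.length_nil]
    omega
  | m1 E₁ Ev H z x y x₁ B α b' E' hx hα hB =>
    refine key _ (simulates_enter hx hα hB h) ?_
    have hg := h.2.1.size (some x, .lam x₁ B) (by simp [mem_of_lookup hx])
    have h1 : B.length = E'.length + 1 := by
      have := congrArg List.length hB
      simpa [Env.subst, Env.rename_eq_map, Env.renameDom] using this
    have h2 := length_le_cellLength B
    simp only [Bite.blockLength] at hg
    simp only [List.length_append, List.length_cons, List.length_nil, Label.principal]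
    omega
  | m2 E₁ Ev H z x y x₁ y₁ v hx hv =>
    refine key _ (simulates_return hx hv h) ?_
    simp only [List.length_append, List.length_cons, List.length_nil, Label.principal]
    omega

theorem Simulates.represents {N : ℕ} {S : State} {c : Config} (h : Simulates N c S) :
    Represents c.mem S := by
  obtain ⟨-, -, as, bs, hl⟩ := h
  exact hl.represents

theorem simulates_execution {N : ℕ} {S₀ S : State} {c : Config} (h : Simulates N c S₀)
    (ρ : Execution S₀ S) : ∃ T, Implements machine c ρ T ∧ Simulates N (machine.run c T) S ∧
      T + 71 * S.act.length ≤ 71 * S₀.act.length + ρ.principal * (91 * N + 71) := by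
  induction ρ with
  | refl => exact ⟨0, h.represents, h, by simp [Execution.principal]⟩
  | tail ρ l hS ih =>
    obtain ⟨T, hI, hs, hT⟩ := ih
    obtain ⟨n, hn, hs', hn'⟩ := simulates_step hS hs
    rw [← run_add] at hs'
    refine ⟨T + n, ⟨⟨T, by omega, hI⟩, hs'.represents⟩, hs', ?_⟩
    simp only [Execution.principal, add_mul]
    omega

/-- The last state may be reached later, as long as the memory is the same. -/
theorem Implements.delay {P : Program} {c : Config} {S₀ S : State} {ρ : Execution S₀ S} {T T' : ℕ}
    (h : Implements P c ρ T) (hT : T ≤ T') (hm : (P.run c T').mem = (P.run c T).mem) :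
    Implements P c ρ T' := by
  cases ρ with
  | refl => simpa [Implements, hm] using h
  | tail ρ l hS =>
    obtain ⟨⟨T₀, h0, hI⟩, hr⟩ := h
    exact ⟨⟨T₀, by omega, hI⟩, by rwa [hm]⟩

/-- With an empty active environment, the first instruction of the main loop halts. -/
theorem run_halt {N : ℕ} {S : State} {c : Config} (h : Simulates N c S) (hS : S.act = []) :
    (machine.run c 1).mem = c.mem ∧ (machine.run c 1).Halted machine := by
  obtain ⟨pc, m⟩ := c
  obtain ⟨rfl, -, as, bs, hl⟩ := h
  have has : as = [] := by
    have := hl.length_act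
    rw [hS] at this
    exact List.length_eq_zero_iff.1 this.symm
  have h0 : m 0 = 0 := by
    have := hl.act
    rw [has] at this
    exact this
  have hr : machine.run ⟨0, m⟩ 1 = ⟨90, m⟩ := by
    simp [Program.run, Program.step, machine, Instr.exec, h0]
  rw [hr]
  exact ⟨rfl, by simp [Config.Halted, machine]⟩

end RCAM

theorem mainTheorem10 :
    ∃ (P : RCAM.Program) (k c : ℕ), ∀ (t : RCAM.Term), t.Closed →
      ∀ (S : RCAM.State) (ρ : RCAM.Execution (RCAM.State.init (RCAM.crumb t)) S),
        ∃ T : ℕ, T ≤ c * ((ρ.principal + 1) * t.size) ∧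
          RCAM.Implements P ⟨0, RCAM.initMem k (RCAM.crumb t)⟩ ρ T ∧
          (S.act = [] → (P.run ⟨0, RCAM.initMem k (RCAM.crumb t)⟩ T).Halted P) := by
  refine ⟨RCAM.machine, 21, 815, fun t ht S ρ => ?_⟩
  set N := RCAM.Env.cellLength (RCAM.crumb t) with hN
  have hinit : RCAM.Simulates N ⟨0, RCAM.initMem 21 (RCAM.crumb t)⟩
      (RCAM.State.init (RCAM.crumb t)) :=
    ⟨rfl, by simpa [RCAM.State.init] using RCAM.good_crumb ht, _, _, RCAM.layout_init _⟩
  obtain ⟨T, hI, hs, hT⟩ := RCAM.simulates_execution hinit ρ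
  have hNt : N ≤ 5 * t.size := (RCAM.crumbSpec t t.bound le_rfl).length
  have hlen : (RCAM.crumb t).length ≤ N := RCAM.length_le_cellLength _
  have hsize : 1 ≤ t.size := by cases t <;> simp [RCAM.Term.size]
  have hbound : T + 1 ≤ 815 * ((ρ.principal + 1) * t.size) := by
    have h1 : ρ.principal * (91 * N + 71) ≤ ρ.principal * (526 * t.size) :=
      Nat.mul_le_mul_left _ (by omega)
    have h2 : (RCAM.State.init (RCAM.crumb t)).act.length ≤ 5 * t.size := hlen.trans hNt
    have h3 : ρ.principal * (526 * t.size) = 526 * (ρ.principal * t.size) := by ring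
    rw [add_mul, one_mul]
    omega
  by_cases hS : S.act = []
  · -- one more step leaves the main loop
    obtain ⟨hm, hh⟩ := RCAM.run_halt hs hS
    rw [← RCAM.run_add] at hm hh
    exact ⟨T + 1, hbound, hI.delay (by omega) hm, fun _ => hh⟩
  · exact ⟨T, by omega, hI, fun h => absurd h hS⟩
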